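/- Let $N\ge 1$ and let $\Omega\subset\mathbb{R}^N$ be a bounded open set with Lipschitz boundary, that is, near each boundary point, in suitable orthonormal coordinates, $\Omega$ is the strict epigraph of a Lipschitz function of $N-1$ variables. Let $A:\mathbb{R}^N\to\mathbb{R}^N$ be measurable and bounded on compact sets, with $A\in C^2(\overline\Omega)$, i.e. $A$ is continuous on $\overline\Omega$, of class $C^2$ in $\Omega$, and its derivatives in $\Omega$ of order at most $2$ extend continuously to $\overline\Omega$. Let $u\in H^1_A(\Omega)$, i.e. $u\in L^2(\Omega,\mathbb{C})$ has a weak gradient $\nabla u$ in $\Omega$ with $\nabla u-\mathrm{i}A u\in L^2(\Omega,\mathbb{C}^N)$. Then $$ \lim_{s\nearrow 1}(1-s)\int_{\Omega}\int_{\Omega}\frac{\left|u(x)-e^{\mathrm{i}(x-y)\cdot A\left(\frac{x+y}{2}\right)}u(y)\right|^2}{|x-y|^{N+2s}}\,dx\,dy=K_N\int_{\Omega}|\nabla u-\mathrm{i}A(x)u|^2\,dx, $$ where $$ K_N=\frac12\int_{\mathbb{S}^{N-1}}|\omega\cdot\mathbf{e}|^2\,d\mathcal{H}^{N-1}(\omega),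 $$ $\mathbb{S}^{N-1}$ is the unit sphere of $\mathbb{R}^N$ with its surface measure $\mathcal{H}^{N-1}$, and $\mathbf{e}$ is any unit vector of $\mathbb{R}^N$. -/

import Mathlib

open MeasureTheory Set Filter Topology
open scoped ContDiff ENNReal

noncomputable section

namespace MagneticBBM

/-- `ℝ^N` with its Euclidean norm. -/
abbrev RN (N : ℕ) : Type := EuclideanSpace ℝ (Fin N)

/-- `ℂ^N` with its Hermitian norm. -/
abbrev CN (N : ℕ) : Type := EuclideanSpace ℂ (Fin N)

/-- `Ω` has Lipschitz boundary: near each boundary point, in suitable orthonormal coordinates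
(the last one being the coordinate along the unit vector `ν`), `Ω` is the strict epigraph of a
Lipschitz function `γ` of the remaining coordinates. The function `γ` is only ever evaluated at
`x - ⟪x, ν⟫ ν`, the projection of `x` to the hyperplane orthogonal to `ν`. -/
def HasLipschitzBoundary {N : ℕ} (Ω : Set (RN N)) : Prop :=
  ∀ x₀ ∈ frontier Ω, ∃ r : ℝ, 0 < r ∧ ∃ ν : RN N, ‖ν‖ = 1 ∧
    ∃ (L : NNReal) (γ : RN N → ℝ), LipschitzWith L γ ∧
      ∀ x ∈ Metric.ball x₀ r, (x ∈ Ω ↔ γ (x - inner ℝ x ν • ν) < inner ℝ x ν)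

/-- `A ∈ C²(Ω̄)`: `A` is continuous on the closure of `Ω`, of class `C²` in `Ω`, and its
derivatives in `Ω` of order at most two extend continuously to the closure. -/
def IsC2OnClosure {N : ℕ} (Ω : Set (RN N)) (A : RN N → RN N) : Prop :=
  ContinuousOn A (closure Ω) ∧ ContDiffOn ℝ 2 A Ω ∧
    ∀ k : ℕ, k ≤ 2 → ∃ g : RN N → ContinuousMultilinearMap ℝ (fun _ : Fin k => RN N) (RN N),
      ContinuousOn g (closure Ω) ∧ EqOn g (iteratedFDeriv ℝ k A) Ω

/-- `A` is bounded on every compact set. -/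
def IsLocallyBounded {N : ℕ} (A : RN N → RN N) : Prop :=
  ∀ K : Set (RN N), IsCompact K → Bornology.IsBounded (A '' K)

/-- `Du` is the weak (distributional) gradient of `u` in `Ω`. -/
def HasWeakGradient {N : ℕ} (Ω : Set (RN N)) (u : RN N → ℂ) (Du : RN N → CN N) : Prop :=
  LocallyIntegrableOn u Ω ∧ LocallyIntegrableOn Du Ω ∧
    ∀ φ : RN N → ℝ, ContDiff ℝ ∞ φ → HasCompactSupport φ → tsupport φ ⊆ Ω → ∀ j : Fin N,
      ∫ x in Ω, (fderiv ℝ φ x (EuclideanSpace.single j 1) : ℂ) * u x =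
        -∫ x in Ω, (φ x : ℂ) * Du x j

/-- The vector field `∇u - i A u`, where `Du` stands for `∇u`. -/
def magneticGradient {N : ℕ} (A : RN N → RN N) (u : RN N → ℂ) (Du : RN N → CN N)
    (x : RN N) : CN N :=
  WithLp.toLp 2 (fun j => Du x j - Complex.I * (A x j : ℂ) * u x)

/-- `u ∈ H¹_A(Ω)`: `u ∈ L²(Ω, ℂ)` has a weak gradient with `∇u - i A u` square integrable. -/
def MemMagneticH1 {N : ℕ} (Ω : Set (RN N)) (A : RN N → RN N) (u : RN N → ℂ) : Prop :=
  MemLp u 2 (volume.restrict Ω) ∧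
    ∃ Du : RN N → CN N, HasWeakGradient Ω u Du ∧
      MemLp (magneticGradient A u Du) 2 (volume.restrict Ω)

/-- The integral of `|∇u - i A u|²` over `Ω`, where `Du` stands for `∇u`. -/
def magneticEnergy {N : ℕ} (Ω : Set (RN N)) (A : RN N → RN N) (u : RN N → ℂ)
    (Du : RN N → CN N) : ℝ≥0∞ :=
  ∫⁻ x in Ω, ENNReal.ofReal (‖magneticGradient A u Du x‖ ^ 2)

/-- The magnetic Gagliardo double integral over `Ω × Ω`. -/
def magneticGagliardo {N : ℕ} (s : ℝ) (Ω : Set (RN N)) (A : RN N → RN N) (u : RN N → ℂ) :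
    ℝ≥0∞ :=
  ∫⁻ x in Ω, ∫⁻ y in Ω, ENNReal.ofReal
    (‖u x - Complex.exp (Complex.I *
        ((inner ℝ (x - y) (A ((2⁻¹ : ℝ) • (x + y))) : ℝ) : ℂ)) * u y‖ ^ 2
      / ‖x - y‖ ^ ((N : ℝ) + 2 * s))

/-- `½ ∫_{S^{N-1}} |ω · e|² dH^{N-1}(ω)`. The measure `volume.toSphere` is the usual surface
measure on the unit sphere (it agrees with the normalized `(N-1)`-dimensional Hausdorff measure,
and with the counting measure of `{-1, 1}` when `N = 1`). -/
def bbmConstant {N : ℕ} (e : RN N) : ℝ :=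
  (1 / 2) * ∫ w : Metric.sphere (0 : RN N) 1, |inner ℝ (w : RN N) e| ^ 2
    ∂((volume : Measure (RN N)).toSphere)

end MagneticBBM

end

namespace MagneticBBM

/-! ### Continuity of translations and Minkowski's inequality in L². -/

section Translation

/-! Put `y = x + h`. The double integral becomes the integral of `|h|^{-N-2s} F(h)`, where `F(h)` is
the squared L² norm of the magnetic difference with step `h`. As `s → 1` the weights
`(1-s)|h|^{-N-2s}` concentrate at the origin, so only the second order behaviour of `F` there
matters. Two facts carry the proof.

The first is the expansion `isSmall_magneticDifference_add_pairing`: with `V = ∇u - iAu`, the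
magnetic difference is `-h·V + o(|h|)` in L². Where the segment from `x` to `x + h` stays in `Ω`,
the increment of `u` is the integral of `h·∇u` along it (`IsWeakGradient.ae_sub_eq`), and continuity
of translations in L² replaces this integral by `h·∇u(x)`. The phase is linearised, and `A` at the
midpoint is handled by translating `u` and then `Au`. Where the segment leaves `Ω`, the Lipschitz
charts give a detour inside `Ω` of length comparable to `|h|`. The detour lies in a thin boundary
layer, where the L² norm of the gradient tends to zero, so these pairs contribute `o(|h|)`
(`isSmall_crossing`). No extension of `u` across the boundary is made beyond extension by zero.

The second is the concentration `tendsto_kernel`. By reflection invariance the integral of a radial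
weight against `|h·z|²` is `|z|²` times a moment independent of `z`. In polar coordinates `(1-s)`
times this moment over `|h| < δ` equals `K_N δ^{2-2s}` (`radialMoment_kernel`), which tends to `K_N`
for every `δ > 0`. The part `|h| ≥ δ` vanishes in the limit because `F` is integrable. -/

theorem eLpNorm_two_sq {α F : Type*} [MeasurableSpace α] {μ : Measure α} [NormedAddCommGroup F]
    (f : α → F) : eLpNorm f 2 μ ^ 2 = ∫⁻ x, ‖f x‖ₑ ^ 2 ∂μ := by
  have := eLpNorm_nnreal_pow_eq_lintegral (μ := μ) (f := f) (p := 2) (by norm_num)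
  simpa using this

variable {E F : Type*} [NormedAddCommGroup E] [InnerProductSpace ℝ E] [FiniteDimensional ℝ E]
  [MeasurableSpace E] [BorelSpace E] [NormedAddCommGroup F]

/-- Translations act continuously on `L²`. -/
theorem tendsto_eLpNorm_translate_sub {f : E → F} (hf : MemLp f 2 volume) :
    Tendsto (fun h : E => eLpNorm (fun x => f (x + h) - f x) 2 volume) (𝓝 0) (𝓝 0) := by
  have : Fact ((2 : ℝ≥0∞) ≠ ⊤) := ⟨by norm_num⟩
  have hc : Continuous fun h : E => DomAddAct.mk h +ᵥ hf.toLp f :=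
    DomAddAct.continuous_mk.vadd continuous_const
  have h1 := (hc.tendsto 0).edist (tendsto_const_nhds (x := hf.toLp f))
  have h0 : DomAddAct.mk (0 : E) +ᵥ hf.toLp f = hf.toLp f := by
    rw [DomAddAct.mk_vadd_toLp]; simp
  rw [h0, edist_self] at h1
  refine h1.congr fun h => ?_
  rw [DomAddAct.mk_vadd_toLp, Lp.edist_toLp_toLp]
  congr 1
  ext x
  simp [add_comm]

/-- Cauchy–Schwarz against the constant 1 on an interval of length one. -/
theorem lintegral_Ioc_sq_le {f : ℝ → ℝ≥0∞} (hf : Measurable f) :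
    (∫⁻ t in Ioc (0 : ℝ) 1, f t) ^ 2 ≤ ∫⁻ t in Ioc (0 : ℝ) 1, f t ^ 2 := by
  have h := ENNReal.lintegral_mul_le_Lp_mul_Lq (volume.restrict (Ioc (0 : ℝ) 1))
    Real.HolderConjugate.two_two hf.aemeasurable (aemeasurable_const (b := (1 : ℝ≥0∞)))
  simp only [Pi.mul_apply, mul_one, ENNReal.one_rpow, lintegral_const, Measure.restrict_apply,
    MeasurableSet.univ, univ_inter, Real.volume_Ioc, sub_zero, ENNReal.ofReal_one] at h
  calc _ ≤ ((∫⁻ t in Ioc (0 : ℝ) 1, f t ^ (2 : ℝ)) ^ (1 / 2 : ℝ)) ^ 2 := by gcongr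
    _ = _ := by
      rw [← ENNReal.rpow_natCast, ← ENNReal.rpow_mul]
      norm_num

/-- Minkowski's integral inequality in the L² case, from Cauchy–Schwarz in `t` followed by Tonelli.
-/
theorem eLpNorm_intervalIntegral_le {α : Type*} [MeasurableSpace α] {μ : Measure α} [SFinite μ]
    [NormedSpace ℝ F] {G : ℝ → α → F} (hG : StronglyMeasurable (Function.uncurry G)) {c : ℝ≥0∞}
    (hc : ∀ t ∈ Ioc (0 : ℝ) 1, eLpNorm (G t) 2 μ ≤ c) :
    eLpNorm (fun x => ∫ t in (0 : ℝ)..1, G t x) 2 μ ≤ c := by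
  rw [← ENNReal.pow_le_pow_left_iff (n := 2) (by norm_num), eLpNorm_two_sq]
  have hm : Measurable fun p : ℝ × α => ‖G p.1 p.2‖ₑ := hG.enorm
  calc ∫⁻ x, ‖∫ t in (0 : ℝ)..1, G t x‖ₑ ^ 2 ∂μ
      ≤ ∫⁻ x, (∫⁻ t in Ioc (0 : ℝ) 1, ‖G t x‖ₑ) ^ 2 ∂μ := by
        gcongr with x
        rw [intervalIntegral.integral_of_le zero_le_one]
        exact enorm_integral_le_lintegral_enorm _
    _ ≤ ∫⁻ x, (∫⁻ t in Ioc (0 : ℝ) 1, ‖G t x‖ₑ ^ 2) ∂μ := by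
        gcongr with x
        exact lintegral_Ioc_sq_le (hm.comp (measurable_id.prodMk measurable_const))
    _ = ∫⁻ t in Ioc (0 : ℝ) 1, ∫⁻ x, ‖G t x‖ₑ ^ 2 ∂μ := by
        rw [lintegral_lintegral_swap]
        exact ((hm.comp measurable_swap).pow_const 2).aemeasurable
    _ ≤ ∫⁻ t in Ioc (0 : ℝ) 1, c ^ 2 := by
        refine setLIntegral_mono' measurableSet_Ioc fun t ht => ?_
        rw [← eLpNorm_two_sq]
        gcongr
        exact hc t ht
    _ = c ^ 2 := by simp

theorem eLpNorm_comp_add_right (f : E → F) (hf : StronglyMeasurable f) (h : E) :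
    eLpNorm (fun x => f (x + h)) 2 volume = eLpNorm f 2 volume :=
  eLpNorm_comp_measurePreserving (g := f) hf.aestronglyMeasurable
    (measurePreserving_add_right volume h)

end Translation

/-! ### Increments along segments as integrals of the weak gradient. -/

section Segment

variable {N : ℕ}

/-- `∑ v_j z_j` for a real vector `v` and a complex vector `z`. -/
def pairing (v : RN N) (z : CN N) : ℂ := ∑ j, (v j : ℂ) * z j

theorem norm_pairing_le (v : RN N) (z : CN N) : ‖pairing v z‖ ≤ ‖v‖ * ‖z‖ := by
  have h := norm_inner_le_norm (𝕜 := ℂ) (WithLp.toLp 2 (fun j => (v j : ℂ)) : CN N) z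
  have h1 : ‖(WithLp.toLp 2 (fun j => (v j : ℂ)) : CN N)‖ = ‖v‖ := by
    simp [EuclideanSpace.norm_eq]
  rw [h1] at h
  refine le_trans (le_of_eq ?_) h
  simp [pairing, PiLp.inner_apply, mul_comm]

theorem pairing_sub_right (v : RN N) (z w : CN N) :
    pairing v (z - w) = pairing v z - pairing v w := by
  simp [pairing, mul_sub, Finset.sum_sub_distrib]

theorem continuous_pairing : Continuous fun p : RN N × CN N => pairing p.1 p.2 := by
  unfold pairing
  fun_prop

/-- The points from which the segment in direction `v` stays in `Ω`. -/
def segmentCore (Ω : Set (RN N)) (v : RN N) : Set (RN N) :=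
  {x | ∀ t ∈ Icc (0 : ℝ) 1, x + t • v ∈ Ω}

/-- Tube lemma over the compact interval `[0, 1]`. Openness allows test functions supported in the
core. -/
theorem isOpen_segmentCore {Ω : Set (RN N)} (hΩ : IsOpen Ω) (v : RN N) :
    IsOpen (segmentCore Ω v) := by
  rw [isOpen_iff_eventually]
  intro x hx
  refine isCompact_Icc.eventually_forall_of_forall_eventually fun t ht => ?_
  have hc : Continuous fun p : RN N × ℝ => p.1 + p.2 • v := by fun_prop
  exact hc.continuousAt.eventually (hΩ.mem_nhds (hx t ht))

/-- Weak gradient in `Ω` of a function that is integrable on the whole space. -/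
def IsWeakGradient (Ω : Set (RN N)) (U : RN N → ℂ) (W : RN N → CN N) : Prop :=
  ∀ φ : RN N → ℝ, ContDiff ℝ ∞ φ → HasCompactSupport φ → tsupport φ ⊆ Ω → ∀ j : Fin N,
    ∫ x, (fderiv ℝ φ x (EuclideanSpace.single j 1) : ℂ) * U x = -∫ x, (φ x : ℂ) * W x j

theorem fderiv_apply_eq_sum (φ : RN N → ℝ) (x v : RN N) :
    fderiv ℝ φ x v = ∑ j, v j * fderiv ℝ φ x (EuclideanSpace.single j 1) := by
  conv_lhs => rw [← (EuclideanSpace.basisFun (Fin N) ℝ).sum_repr v]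
  simp

theorem exists_bound_fderiv {φ : RN N → ℝ} (h1 : ContDiff ℝ ∞ φ) (h2 : HasCompactSupport φ)
    (v : RN N) : Continuous (fun x => fderiv ℝ φ x v) ∧ ∃ C, ∀ x, ‖fderiv ℝ φ x v‖ ≤ C := by
  have hc : Continuous fun x => fderiv ℝ φ x v :=
    (h1.continuous_fderiv (by simp)).clm_apply continuous_const
  exact ⟨hc, (h2.fderiv_apply ℝ v).exists_bound_of_continuous hc⟩

theorem integrable_ofReal_mul {f : RN N → ℝ} (hf : Continuous f) (hb : ∃ C, ∀ x, ‖f x‖ ≤ C)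
    {U : RN N → ℂ} (hU : Integrable U) : Integrable fun x => (f x : ℂ) * U x := by
  obtain ⟨C, hC⟩ := hb
  exact hU.bdd_mul (c := C) (Complex.continuous_ofReal.comp hf).aestronglyMeasurable
    (Eventually.of_forall fun x => by simpa using hC x)

theorem integrable_coord {W : RN N → CN N} (hW : Integrable W) (j : Fin N) :
    Integrable fun x => W x j :=
  (EuclideanSpace.proj (𝕜 := ℂ) j).integrable_comp hW

theorem integrable_pairing {W : RN N → CN N} (hW : Integrable W) (v : RN N) :
    Integrable fun x => pairing v (W x) :=
  integrable_finsetSum _ fun j _ => (integrable_coord hW j).const_mul _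

theorem IsWeakGradient.integral_fderiv {Ω : Set (RN N)} {U : RN N → ℂ} {W : RN N → CN N}
    (h : IsWeakGradient Ω U W) (hU : Integrable U) (hW : Integrable W) {φ : RN N → ℝ}
    (h1 : ContDiff ℝ ∞ φ) (h2 : HasCompactSupport φ) (h3 : tsupport φ ⊆ Ω) (v : RN N) :
    ∫ x, (fderiv ℝ φ x v : ℂ) * U x = -∫ x, (φ x : ℂ) * pairing v (W x) := by
  have hl (x : RN N) : (fderiv ℝ φ x v : ℂ) * U x =
      ∑ j, (v j : ℂ) * ((fderiv ℝ φ x (EuclideanSpace.single j 1) : ℂ) * U x) := by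
    rw [fderiv_apply_eq_sum]
    push_cast
    rw [Finset.sum_mul]
    simp [mul_assoc]
  have hr (x : RN N) : (φ x : ℂ) * pairing v (W x) =
      ∑ j, (v j : ℂ) * ((φ x : ℂ) * W x j) := by
    rw [pairing, Finset.mul_sum]
    exact Finset.sum_congr rfl fun j _ => by ring
  simp_rw [hl, hr]
  rw [integral_finsetSum, integral_finsetSum, ← Finset.sum_neg_distrib]
  · refine Finset.sum_congr rfl fun j _ => ?_
    rw [integral_const_mul, integral_const_mul, h φ h1 h2 h3 j, mul_neg]
  · exact fun j _ => (integrable_ofReal_mul h1.continuous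
      (h2.exists_bound_of_continuous h1.continuous) (integrable_coord hW j)).const_mul _
  · intro j _
    obtain ⟨hc, hb⟩ := exists_bound_fderiv h1 h2 (EuclideanSpace.single j (1 : ℝ))
    exact (integrable_ofReal_mul hc hb hU).const_mul _

/-- Each slice in `t` has the same L¹ norm by translation invariance; this justifies the later uses
of Fubini. -/
theorem integrable_prod_translate {g : RN N → ℂ} (hg : Integrable g) (hgm : Measurable g)
    (v : RN N) :
    Integrable (fun p : ℝ × RN N => g (p.2 + p.1 • v))
      ((volume.restrict (Ioc (0 : ℝ) 1)).prod volume) := by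
  have hm : Measurable fun p : ℝ × RN N => g (p.2 + p.1 • v) := hgm.comp (by fun_prop)
  rw [integrable_prod_iff hm.aestronglyMeasurable]
  refine ⟨Eventually.of_forall fun t => hg.comp_add_right (t • v), ?_⟩
  have (t : ℝ) : ∫ x, ‖g (x + t • v)‖ = ∫ x, ‖g x‖ :=
    integral_add_right_eq_self (fun x => ‖g x‖) (t • v)
  simp only [this]
  exact integrable_const _

theorem fderiv_comp_sub_smul {φ : RN N → ℝ} (h1 : ContDiff ℝ ∞ φ) (x v : RN N) :
    φ (x - v) - φ x = ∫ t in (0 : ℝ)..1, -fderiv ℝ φ (x - t • v) v := by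
  have hd (t : ℝ) : HasDerivAt (fun t : ℝ => φ (x - t • v)) (-fderiv ℝ φ (x - t • v) v) t := by
    have h := ((h1.differentiable (by simp)) (x - t • v)).hasFDerivAt
    have h' : HasDerivAt (fun t : ℝ => x - t • v) (-v) t := by
      simpa using ((hasDerivAt_id t).smul_const v).const_sub x
    simpa [Function.comp_def] using h.comp_hasDerivAt t h'
  rw [intervalIntegral.integral_eq_sub_of_hasDerivAt (fun t _ => hd t)]
  · simp
  · apply Continuous.intervalIntegrable
    exact (((h1.continuous_fderiv (by simp)).comp (by fun_prop)).clm_apply continuous_const).neg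

/-- A function with a weak gradient is the integral of the gradient along almost every segment
contained in `Ω`. -/
theorem IsWeakGradient.ae_sub_eq {Ω : Set (RN N)} (hΩ : IsOpen Ω) {U : RN N → ℂ}
    {W : RN N → CN N} (h : IsWeakGradient Ω U W) (hU : Integrable U) (hW : Integrable W)
    (hWm : Measurable W) (v : RN N) :
    ∀ᵐ x, x ∈ segmentCore Ω v →
      U (x + v) - U x = ∫ t in (0 : ℝ)..1, pairing v (W (x + t • v)) := by
  set g : RN N → ℂ := fun x => pairing v (W x) with hg
  have hgi : Integrable g := integrable_pairing hW v
  have hgm : Measurable g := (continuous_pairing.measurable).comp (measurable_const.prodMk hWm)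
  have hP := integrable_prod_translate hgi hgm v
  have hI : Integrable fun x => ∫ t in (0 : ℝ)..1, g (x + t • v) := by
    simp_rw [intervalIntegral.integral_of_le zero_le_one]
    exact hP.integral_prod_right
  have hUv : Integrable fun x => U (x + v) := hU.comp_add_right v
  -- It suffices to test against `φ` supported in the core: the translates `φ(· - t v)`, `0 ≤ t ≤
  -- 1`, are then supported in `Ω` and are admissible in the definition of the weak gradient.
  have key := (isOpen_segmentCore hΩ v).ae_eq_zero_of_integral_contDiff_smul_eq_zero
    (μ := volume) (f := fun x => (U (x + v) - U x) - ∫ t in (0 : ℝ)..1, g (x + t • v))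
    (((hUv.sub hU).sub hI).locallyIntegrable.locallyIntegrableOn _ :) ?_
  · filter_upwards [key] with x hx hxS
    exact sub_eq_zero.mp (hx hxS)
  intro φ h1 h2 h3
  have hb := h2.exists_bound_of_continuous h1.continuous
  have hsh (t : ℝ) (ht : t ∈ Ioc (0 : ℝ) 1) :
      ∫ x, (fderiv ℝ φ (x - t • v) v : ℂ) * U x = -∫ x, (φ x : ℂ) * g (x + t • v) := by
    have e1 (x : RN N) : fderiv ℝ φ (x - t • v) = fderiv ℝ (fun y => φ (y - t • v)) x := by
      rw [fderiv_comp_sub]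
    simp_rw [e1]
    rw [h.integral_fderiv hU hW (φ := fun y => φ (y - t • v))
      (h1.comp (contDiff_id.sub contDiff_const)) (h2.comp_homeomorph (Homeomorph.subRight (t • v)))]
    · congr 1
      rw [← integral_add_right_eq_self _ (t • v)]
      simp [hg]
    · intro x hx
      have : x - t • v ∈ tsupport φ :=
        tsupport_comp_subset_preimage φ (f := fun y : RN N => y - t • v) (by fun_prop) hx
      simpa using h3 this t ⟨ht.1.le, ht.2⟩
  obtain ⟨hfc, Cf, hCf⟩ := exists_bound_fderiv h1 h2 v
  have hP1 : Integrable (fun p : ℝ × RN N => -((fderiv ℝ φ (p.2 - p.1 • v) v : ℂ) * U p.2))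
      ((volume.restrict (Ioc (0 : ℝ) 1)).prod volume) := by
    refine Integrable.neg ?_
    refine (hU.comp_snd (volume.restrict (Ioc (0 : ℝ) 1))).bdd_mul (c := Cf) ?_ ?_
    · exact (Complex.continuous_ofReal.comp (hfc.comp (by fun_prop))).aestronglyMeasurable
    · exact Eventually.of_forall fun p => by simpa using hCf (p.2 - p.1 • v)
  have hP2 : Integrable (fun p : ℝ × RN N => (φ p.2 : ℂ) * g (p.2 + p.1 • v))
      ((volume.restrict (Ioc (0 : ℝ) 1)).prod volume) := by
    obtain ⟨C, hC⟩ := hb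
    refine hP.bdd_mul (c := C) ?_ ?_
    · exact (Complex.continuous_ofReal.comp (h1.continuous.comp (by fun_prop))).aestronglyMeasurable
    · exact Eventually.of_forall fun p => by simpa using hC p.2
  have hb' : ∃ C, ∀ x, ‖φ (x - v)‖ ≤ C := by
    obtain ⟨C, hC⟩ := hb
    exact ⟨C, fun x => hC _⟩
  have hφv : Continuous fun x => φ (x - v) := h1.continuous.comp (by fun_prop)
  -- The shift is moved onto `φ`, the fundamental theorem of calculus is applied to the smooth `φ`,
  -- and Fubini is used before and after the integration by parts in each slice `t`.
  have lhs : ∫ x, (φ x : ℂ) * (U (x + v) - U x) =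
      ∫ x, (φ x : ℂ) * ∫ t in (0 : ℝ)..1, g (x + t • v) := by
    calc ∫ x, (φ x : ℂ) * (U (x + v) - U x)
        = (∫ x, (φ x : ℂ) * U (x + v)) - ∫ x, (φ x : ℂ) * U x := by
          simp_rw [mul_sub]
          exact integral_sub (integrable_ofReal_mul h1.continuous hb hUv)
            (integrable_ofReal_mul h1.continuous hb hU)
      _ = (∫ x, (φ (x - v) : ℂ) * U x) - ∫ x, (φ x : ℂ) * U x := by
          congr 1
          rw [← integral_add_right_eq_self (fun x => (φ (x - v) : ℂ) * U x) v]
          simp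
      _ = ∫ x, ((φ (x - v) - φ x : ℝ) : ℂ) * U x := by
          rw [← integral_sub (integrable_ofReal_mul hφv hb' hU)
            (integrable_ofReal_mul h1.continuous hb hU)]
          simp [sub_mul]
      _ = ∫ x, ∫ t in Ioc (0 : ℝ) 1, -((fderiv ℝ φ (x - t • v) v : ℂ) * U x) := by
          congr 1
          ext x
          rw [fderiv_comp_sub_smul h1, intervalIntegral.integral_of_le zero_le_one,
            ← integral_complex_ofReal, ← integral_mul_const]
          simp
      _ = ∫ t in Ioc (0 : ℝ) 1, ∫ x, -((fderiv ℝ φ (x - t • v) v : ℂ) * U x) :=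
          (integral_integral_swap hP1).symm
      _ = ∫ t in Ioc (0 : ℝ) 1, ∫ x, (φ x : ℂ) * g (x + t • v) := by
          refine setIntegral_congr_fun measurableSet_Ioc fun t ht => ?_
          rw [integral_neg, hsh t ht, neg_neg]
      _ = ∫ x, ∫ t in Ioc (0 : ℝ) 1, (φ x : ℂ) * g (x + t • v) := integral_integral_swap hP2
      _ = _ := by
          congr 1
          ext x
          rw [integral_const_mul, intervalIntegral.integral_of_le zero_le_one]
  have e2 (x : RN N) : φ x • ((U (x + v) - U x) - ∫ t in (0 : ℝ)..1, g (x + t • v)) =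
      (φ x : ℂ) * (U (x + v) - U x) - (φ x : ℂ) * ∫ t in (0 : ℝ)..1, g (x + t • v) := by
    rw [← mul_sub, Complex.real_smul]
  simp_rw [e2]
  have hi : Integrable fun x => (φ x : ℂ) * (U (x + v) - U x) :=
    integrable_ofReal_mul h1.continuous hb (hUv.sub hU)
  rw [integral_sub hi (integrable_ofReal_mul h1.continuous hb hI), lhs, sub_self]

end Segment

/-! ### Calculus of `o(‖h‖)` quantities. -/

section Small

variable {E : Type*} [NormedAddCommGroup E]

/-- `f h = o(‖h‖)` as `h → 0`, for `ℝ≥0∞`-valued `f`. -/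
def IsSmall (f : E → ℝ≥0∞) : Prop :=
  ∀ ε : ℝ≥0∞, ε ≠ 0 → ∀ᶠ h in 𝓝 (0 : E), f h ≤ ε * ‖h‖ₑ

theorem IsSmall.mono {f g : E → ℝ≥0∞} (hg : IsSmall g) (h : ∀ᶠ x in 𝓝 0, f x ≤ g x) :
    IsSmall f := fun ε hε => by
  filter_upwards [hg ε hε, h] with x h1 h2 using h2.trans h1

theorem IsSmall.add {f g : E → ℝ≥0∞} (hf : IsSmall f) (hg : IsSmall g) :
    IsSmall fun x => f x + g x := fun ε hε => by
  have h2 : ε / 2 ≠ 0 := (ENNReal.half_pos hε).ne'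
  filter_upwards [hf _ h2, hg _ h2] with x h1 h2
  calc _ ≤ ε / 2 * ‖x‖ₑ + ε / 2 * ‖x‖ₑ := add_le_add h1 h2
    _ = _ := by rw [← add_mul, ENNReal.add_halves]

theorem isSmall_sum {ι : Type*} {f : ι → E → ℝ≥0∞} (t : Finset ι) (hf : ∀ i ∈ t, IsSmall (f i)) :
    IsSmall fun x => ∑ i ∈ t, f i x := by
  classical
  induction t using Finset.induction_on with
  | empty => intro ε _; simp
  | insert a s ha ih =>
    simp_rw [Finset.sum_insert ha]
    exact (hf a (by simp)).add (ih fun i hi => hf i (by simp [hi]))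

theorem isSmall_of_tendsto {f g : E → ℝ≥0∞} (hg : Tendsto g (𝓝 0) (𝓝 0))
    (h : ∀ᶠ x in 𝓝 0, f x ≤ ‖x‖ₑ * g x) : IsSmall f := fun ε hε => by
  filter_upwards [h, hg.eventually (Iic_mem_nhds hε.bot_lt)] with x h1 h2
  calc _ ≤ ‖x‖ₑ * g x := h1
    _ ≤ ‖x‖ₑ * ε := by gcongr
    _ = _ := mul_comm _ _

theorem tendsto_const_mul_zero {α : Type*} {l : Filter α} {g : α → ℝ≥0∞} {C : ℝ≥0∞} (hC : C ≠ ⊤)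
    (hg : Tendsto g l (𝓝 0)) : Tendsto (fun x => C * g x) l (𝓝 0) := by
  simpa using ENNReal.Tendsto.const_mul hg (Or.inr hC)

end Small

/-! ### Vanishing of L² mass in thin boundary layers. -/

section Layer

variable {N : ℕ}

/-- The points of `Ω` at distance at most `r` from its complement. -/
def boundaryLayer (Ω : Set (RN N)) (r : ℝ) : Set (RN N) := Metric.cthickening r Ωᶜ ∩ Ω

theorem measurableSet_boundaryLayer {Ω : Set (RN N)} (hΩ : IsOpen Ω) (r : ℝ) :
    MeasurableSet (boundaryLayer Ω r) :=
  Metric.isClosed_cthickening.measurableSet.inter hΩ.measurableSet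

theorem mem_boundaryLayer {Ω : Set (RN N)} {x y : RN N} {r : ℝ} (hx : x ∈ Ω) (hy : y ∉ Ω)
    (h : dist x y ≤ r) : x ∈ boundaryLayer Ω r :=
  ⟨Metric.mem_cthickening_of_dist_le x y r _ hy h, hx⟩

/-- The complement of `Ω` is closed, so its thickenings shrink to it and the layers have measure
tending to zero. Absolute continuity of the integral of `|f|²` concludes. -/
theorem tendsto_eLpNorm_boundaryLayer {F : Type*} [NormedAddCommGroup F] {Ω : Set (RN N)}
    (hΩ : IsOpen Ω) (hb : Bornology.IsBounded Ω) {f : RN N → F} (hf : MemLp f 2 volume) :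
    Tendsto (fun r => eLpNorm ((boundaryLayer Ω r).indicator f) 2 volume) (𝓝 0) (𝓝 0) := by
  have hm : Tendsto (fun r => volume (boundaryLayer Ω r)) (𝓝 0) (𝓝 0) := by
    have : IsFiniteMeasure (volume.restrict Ω) :=
      ⟨by simpa using hb.measure_lt_top⟩
    have h := tendsto_measure_cthickening_of_isClosed (μ := volume.restrict Ω) (s := Ωᶜ)
      ⟨1, one_pos, measure_ne_top _ _⟩ hΩ.isClosed_compl
    have h0 : (volume.restrict Ω) Ωᶜ = 0 := by
      rw [Measure.restrict_apply hΩ.measurableSet.compl]; simp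
    rw [h0] at h
    refine h.congr fun r => ?_
    rw [Measure.restrict_apply Metric.isClosed_cthickening.measurableSet, boundaryLayer]
  rw [ENNReal.tendsto_nhds_zero]
  intro ε hε
  obtain ⟨e, he0, he⟩ : ∃ e : ℝ, 0 < e ∧ ENNReal.ofReal e ≤ ε := by
    rcases eq_or_ne ε ⊤ with rfl | h
    · exact ⟨1, one_pos, le_top⟩
    · exact ⟨ε.toReal, ENNReal.toReal_pos hε.ne' h, ENNReal.ofReal_toReal_le⟩
  obtain ⟨δ, hδ, H⟩ := hf.eLpNorm_indicator_le (by norm_num) (by norm_num) he0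
  filter_upwards [hm.eventually (Iic_mem_nhds (ENNReal.ofReal_pos.mpr hδ))] with r hr
  exact (H _ (measurableSet_boundaryLayer hΩ r) hr).trans he

theorem tendsto_eLpNorm_boundaryLayer_norm {F : Type*} [NormedAddCommGroup F] {Ω : Set (RN N)}
    (hΩ : IsOpen Ω) (hb : Bornology.IsBounded Ω) {f : RN N → F} (hf : MemLp f 2 volume) (c : ℝ) :
    Tendsto (fun h : RN N => eLpNorm ((boundaryLayer Ω (c * ‖h‖)).indicator f) 2 volume)
      (𝓝 0) (𝓝 0) := by
  refine (tendsto_eLpNorm_boundaryLayer hΩ hb hf).comp ?_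
  have : Continuous fun h : RN N => c * ‖h‖ := by fun_prop
  simpa using this.tendsto 0

end Layer

/-! ### Geometry of Lipschitz charts. -/

section Chart

variable {N : ℕ}

/-- Two nearby points of a Lipschitz domain close to the boundary are joined inside the domain by
three segments of comparable length: move inwards, across, and back. -/
theorem HasLipschitzBoundary.exists_detour {Ω : Set (RN N)} (hΩ : HasLipschitzBoundary Ω)
    {x₀ : RN N} (hx₀ : x₀ ∈ frontier Ω) :
    ∃ ρ > 0, ∃ C : ℝ, 0 ≤ C ∧ ∃ ν : RN N, ‖ν‖ = 1 ∧ ∀ x ∈ Metric.ball x₀ ρ, ∀ h : RN N, ‖h‖ < ρ →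
      x ∈ Ω → x + h ∈ Ω → x ∈ segmentCore Ω ((C * ‖h‖) • ν) ∧
        x + h ∈ segmentCore Ω ((C * ‖h‖) • ν) ∧ x + (C * ‖h‖) • ν ∈ segmentCore Ω h := by
  obtain ⟨r, hr, ν, hν, L, γ, hγ, H⟩ := hΩ x₀ hx₀
  have hC : (0 : ℝ) ≤ 2 * L + 1 := by positivity
  have hνν : inner ℝ ν ν = 1 := by rw [real_inner_self_eq_norm_sq, hν]; norm_num
  -- In `C = 2L + 1`, the part `2L` pays for the variation of `γ` when the base point moves by at
  -- most `2‖h‖`, and the 1 for a loss of height at most `‖h‖`. The radius `r / (C + 3)` leaves room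
  -- for `x` and for displacements up to `(C + 2)ρ` inside the chart.
  refine ⟨r / (2 * L + 1 + 3), by positivity, 2 * L + 1, hC, ν, hν, ?_⟩
  intro x hx h hh hxΩ hxh
  set C : ℝ := 2 * L + 1 with hCdef
  set ρ := r / (C + 3) with hρ
  have hρr : (C + 3) * ρ = r := by rw [hρ]; field_simp
  have hh0 := norm_nonneg h
  have hball (w : RN N) (hw : ‖w‖ ≤ (C + 2) * ρ) : x + w ∈ Metric.ball x₀ r := by
    rw [Metric.mem_ball, dist_eq_norm] at hx ⊢
    calc ‖x + w - x₀‖ = ‖(x - x₀) + w‖ := by congr 1; abel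
      _ ≤ ‖x - x₀‖ + ‖w‖ := norm_add_le _ _
      _ < ρ + (C + 2) * ρ := by linarith
      _ = r := by rw [← hρr]; ring
  have hnorm (a b : ℝ) (ha : 0 ≤ a) (hb : b ∈ Icc (0 : ℝ) 1) (ha' : a ≤ C * ‖h‖) :
      ‖b • h + a • ν‖ ≤ (C + 2) * ρ := by
    calc ‖b • h + a • ν‖ ≤ ‖b • h‖ + ‖a • ν‖ := norm_add_le _ _
      _ = b * ‖h‖ + a := by
        rw [norm_smul, norm_smul, hν, Real.norm_of_nonneg ha, Real.norm_of_nonneg hb.1, mul_one]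
      _ ≤ 1 * ‖h‖ + C * ‖h‖ := by gcongr; exact hb.2
      _ ≤ (C + 2) * ‖h‖ := by nlinarith
      _ ≤ (C + 2) * ρ := by gcongr
  have hmem (w : RN N) (hw : ‖w‖ ≤ (C + 2) * ρ) := H (x + w) (hball w hw)
  have hproj (y : RN N) (a : ℝ) :
      (y + a • ν) - inner ℝ (y + a • ν) ν • ν = y - inner ℝ y ν • ν := by
    rw [inner_add_left, real_inner_smul_left, hνν]
    module
  have hup (y : RN N) (a : ℝ) : inner ℝ (y + a • ν) ν = inner ℝ y ν + a := by
    rw [inner_add_left, real_inner_smul_left, hνν, mul_one]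
  have h0 : γ (x - inner ℝ x ν • ν) < inner ℝ x ν := by
    have := hmem 0 (by simp; positivity)
    rw [add_zero] at this
    exact this.mp hxΩ
  have h1 : γ (x + h - inner ℝ (x + h) ν • ν) < inner ℝ (x + h) ν := by
    have := hnorm 0 1 le_rfl ⟨zero_le_one, le_rfl⟩ (by positivity)
    simp only [one_smul, zero_smul, add_zero] at this
    exact (hmem h this).mp hxh
  have hCh : 0 ≤ C * ‖h‖ := by positivity
  -- The first two moves are along `ν`: they fix the projection and only raise the height. Only the
  -- crossing move uses the Lipschitz bound.
  refine ⟨fun t ht => ?_, fun t ht => ?_, fun t ht => ?_⟩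
  · have ht' : 0 ≤ t * (C * ‖h‖) := mul_nonneg ht.1 hCh
    have hle : t * (C * ‖h‖) ≤ C * ‖h‖ := mul_le_of_le_one_left hCh ht.2
    have := hnorm _ 0 ht' ⟨le_rfl, zero_le_one⟩ hle
    rw [zero_smul, zero_add] at this
    rw [smul_smul, hmem _ this, hproj, hup]
    linarith
  · have ht' : 0 ≤ t * (C * ‖h‖) := mul_nonneg ht.1 hCh
    have hle : t * (C * ‖h‖) ≤ C * ‖h‖ := mul_le_of_le_one_left hCh ht.2
    have := hnorm _ 1 ht' ⟨zero_le_one, le_rfl⟩ hle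
    rw [one_smul] at this
    rw [smul_smul, add_assoc, hmem _ this, ← add_assoc, hproj, hup]
    linarith
  · have := hnorm _ t hCh ht le_rfl
    rw [add_assoc, add_comm _ (t • h), hmem _ this, ← add_assoc, hproj, hup]
    have hlip : γ (x + t • h - inner ℝ (x + t • h) ν • ν) ≤
        γ (x - inner ℝ x ν • ν) + L * (2 * ‖h‖) := by
      have hd := hγ.dist_le_mul (x + t • h - inner ℝ (x + t • h) ν • ν) (x - inner ℝ x ν • ν)
      have hn : dist (x + t • h - inner ℝ (x + t • h) ν • ν) (x - inner ℝ x ν • ν) ≤ 2 * ‖h‖ := by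
        rw [dist_eq_norm]
        have e1 : x + t • h - inner ℝ (x + t • h) ν • ν - (x - inner ℝ x ν • ν) =
            t • (h - inner ℝ h ν • ν) := by
          rw [inner_add_left, real_inner_smul_left]
          module
        rw [e1, norm_smul, Real.norm_of_nonneg ht.1]
        have e2 : ‖inner ℝ h ν • ν‖ ≤ ‖h‖ := by
          rw [norm_smul, hν, mul_one]
          simpa [hν] using norm_inner_le_norm (𝕜 := ℝ) h ν
        calc t * ‖h - inner ℝ h ν • ν‖ ≤ 1 * (‖h‖ + ‖inner ℝ h ν • ν‖) := by
              gcongr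
              · exact ht.2
              · exact norm_sub_le _ _
          _ ≤ 2 * ‖h‖ := by linarith
      have : dist (γ (x + t • h - inner ℝ (x + t • h) ν • ν)) (γ (x - inner ℝ x ν • ν)) ≤
          L * (2 * ‖h‖) := hd.trans (by gcongr)
      rw [Real.dist_eq] at this
      linarith [le_abs_self (γ (x + t • h - inner ℝ (x + t • h) ν • ν) -
        γ (x - inner ℝ x ν • ν))]
    have hin : -‖h‖ ≤ inner ℝ (t • h) ν := by
      have : |inner ℝ (t • h) ν| ≤ ‖h‖ := by
        calc |inner ℝ (t • h) ν| ≤ ‖t • h‖ * ‖ν‖ := abs_real_inner_le_norm _ _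
          _ = t * ‖h‖ := by rw [hν, mul_one, norm_smul, Real.norm_of_nonneg ht.1]
          _ ≤ 1 * ‖h‖ := by gcongr; exact ht.2
          _ = ‖h‖ := one_mul _
      exact neg_le_of_abs_le this
    rw [inner_add_left] at hlip ⊢
    have : C * ‖h‖ = L * (2 * ‖h‖) + ‖h‖ := by rw [hCdef]; ring
    linarith

/-- A segment is connected: if it missed the frontier, the interior and the exterior of `Ω` would
disconnect it. -/
theorem exists_frontier_dist_le {Ω : Set (RN N)} {x h : RN N} (hx : x ∈ Ω)
    (hs : x ∉ segmentCore Ω h) : ∃ z ∈ frontier Ω, dist x z ≤ ‖h‖ := by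
  have hs' : ∃ t ∈ Icc (0 : ℝ) 1, x + t • h ∉ Ω := by
    simpa [segmentCore, and_assoc] using hs
  obtain ⟨t, ht, hty⟩ := hs'
  have hp : IsPreconnected ((fun s : ℝ => x + s • h) '' Icc 0 1) :=
    isPreconnected_Icc.image _ (by fun_prop)
  obtain ⟨z, ⟨s, hs, rfl⟩, hz⟩ : (((fun s : ℝ => x + s • h) '' Icc 0 1) ∩ frontier Ω).Nonempty := by
    by_contra hne
    have hd : Disjoint ((fun s : ℝ => x + s • h) '' Icc 0 1) (frontier Ω) :=
      Set.disjoint_iff_inter_eq_empty.mpr (Set.not_nonempty_iff_eq_empty.mp hne)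
    have hcov : ((fun s : ℝ => x + s • h) '' Icc 0 1) ⊆ interior Ω ∪ (closure Ω)ᶜ := by
      intro y hy
      by_contra hy'
      simp only [mem_union, mem_compl_iff, not_or, not_not] at hy'
      exact (Set.disjoint_left.mp hd hy) ⟨hy'.2, hy'.1⟩
    have hx' : x ∈ (fun s : ℝ => x + s • h) '' Icc 0 1 := ⟨0, by simp, by simp⟩
    have hxi : x ∈ interior Ω := (hcov hx').resolve_right fun h => h (subset_closure hx)
    have hty' : x + t • h ∈ (fun s : ℝ => x + s • h) '' Icc 0 1 := ⟨t, ht, rfl⟩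
    have hyi : x + t • h ∈ (closure Ω)ᶜ := (hcov hty').resolve_left fun h => hty (interior_subset h)
    obtain ⟨w, -, hw1, hw2⟩ := hp _ _ isOpen_interior isClosed_closure.isOpen_compl hcov
      ⟨x, hx', hxi⟩ ⟨_, hty', hyi⟩
    exact hw2 (subset_closure (interior_subset hw1))
  refine ⟨_, hz, ?_⟩
  rw [dist_self_add_right, norm_smul, Real.norm_of_nonneg hs.1]
  exact mul_le_of_le_one_left (norm_nonneg _) hs.2

end Chart

/-! ### First order L² estimates for the nonmagnetic increment. -/

variable {N : ℕ}

theorem measurable_pairing (v : RN N) : Measurable fun z : CN N => pairing v z :=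
  (continuous_pairing.comp (continuous_const.prodMk continuous_id)).measurable

theorem eLpNorm_pairing_le (v : RN N) (f : RN N → CN N) :
    eLpNorm (fun x => pairing v (f x)) 2 volume ≤ ‖v‖ₑ * eLpNorm f 2 volume := by
  rw [← ofReal_norm]
  exact eLpNorm_le_mul_eLpNorm_of_ae_le_mul (Eventually.of_forall fun x => norm_pairing_le v (f x)) 2

/-- `U ∈ L²` vanishes off the bounded open set `Ω` and has the weak gradient `W ∈ L²` there. -/
structure IsSobolevPair (Ω : Set (RN N)) (U : RN N → ℂ) (W : RN N → CN N) : Prop where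
  isOpen : IsOpen Ω
  isBounded : Bornology.IsBounded Ω
  measurable_fun : Measurable U
  measurable_grad : Measurable W
  memLp_fun : MemLp U 2 volume
  memLp_grad : MemLp W 2 volume
  fun_eq_zero : ∀ x ∉ Ω, U x = 0
  grad_eq_zero : ∀ x ∉ Ω, W x = 0
  isWeakGradient : IsWeakGradient Ω U W

theorem integrable_of_memLp_two {F : Type*} [NormedAddCommGroup F] {Ω : Set (RN N)}
    (hb : Bornology.IsBounded Ω) {f : RN N → F} (hf : MemLp f 2 volume)
    (h0 : ∀ x ∉ Ω, f x = 0) : Integrable f := by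
  have : IsFiniteMeasure (volume.restrict Ω) := ⟨by simpa using hb.measure_lt_top⟩
  have h1 : IntegrableOn f Ω := (hf.restrict Ω).integrable (by norm_num)
  exact (integrableOn_iff_integrable_of_support_subset fun x hx => by
    by_contra hxΩ
    exact hx (h0 x hxΩ)).mp h1

/-- The points `x` such that `x` and `x + h` lie in `Ω` but the segment between them does not. -/
def crossing (Ω : Set (RN N)) (h : RN N) : Set (RN N) :=
  {x | x ∈ Ω ∧ x + h ∈ Ω ∧ x ∉ segmentCore Ω h}

theorem measurableSet_crossing {Ω : Set (RN N)} (hΩ : IsOpen Ω) (h : RN N) :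
    MeasurableSet (crossing Ω h) :=
  hΩ.measurableSet.inter ((hΩ.measurableSet.preimage (measurable_add_const h)).inter
    (isOpen_segmentCore hΩ h).measurableSet.compl)

theorem eLpNorm_indicator_le_sum {F ι : Type*} [NormedAddCommGroup F]
    {f : RN N → F} (hf : StronglyMeasurable f) {S : Set (RN N)} (hS : MeasurableSet S)
    (t : Finset ι) {B : ι → Set (RN N)} (hB : ∀ i ∈ t, MeasurableSet (B i))
    (hcov : S ⊆ ⋃ i ∈ t, B i) :
    eLpNorm (S.indicator f) 2 volume ≤ ∑ i ∈ t, eLpNorm ((S ∩ B i).indicator f) 2 volume := by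
  have h1 : eLpNorm (S.indicator f) 2 volume ≤
      eLpNorm (∑ i ∈ t, fun x => ‖(S ∩ B i).indicator f x‖) 2 volume := by
    refine eLpNorm_mono_real fun x => ?_
    rw [Finset.sum_apply]
    by_cases hx : x ∈ S
    · obtain ⟨i, hi, hxi⟩ := mem_iUnion₂.mp (hcov hx)
      refine le_trans (le_of_eq ?_) (Finset.single_le_sum
        (f := fun i => ‖(S ∩ B i).indicator f x‖) (fun _ _ => norm_nonneg _) hi)
      rw [indicator_of_mem hx, indicator_of_mem (show x ∈ S ∩ B i from ⟨hx, hxi⟩)]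
    · rw [indicator_of_notMem hx, norm_zero]
      exact Finset.sum_nonneg fun _ _ => norm_nonneg _
  refine h1.trans ((eLpNorm_sum_le (fun i hi => ?_) (by norm_num)).trans
    (Finset.sum_le_sum fun i _ => (eLpNorm_norm _).le))
  exact ((hf.indicator (hS.inter (hB i hi))).norm).aestronglyMeasurable

namespace IsSobolevPair

variable {Ω : Set (RN N)} {U : RN N → ℂ} {W : RN N → CN N}

theorem integrable_fun (h : IsSobolevPair Ω U W) : Integrable U :=
  integrable_of_memLp_two h.isBounded h.memLp_fun h.fun_eq_zero

theorem integrable_grad (h : IsSobolevPair Ω U W) : Integrable W :=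
  integrable_of_memLp_two h.isBounded h.memLp_grad h.grad_eq_zero

theorem ae_sub_eq (h : IsSobolevPair Ω U W) (v : RN N) :
    ∀ᵐ x, x ∈ segmentCore Ω v →
      U (x + v) - U x = ∫ t in (0 : ℝ)..1, pairing v (W (x + t • v)) :=
  h.isWeakGradient.ae_sub_eq h.isOpen h.integrable_fun h.integrable_grad h.measurable_grad v

theorem eLpNorm_difference_le (h : IsSobolevPair Ω U W) {S Z : Set (RN N)}
    (hZ : MeasurableSet Z) (v w : RN N) (hS : ∀ x ∈ S, x + w ∈ segmentCore Ω v)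
    (hSZ : ∀ x ∈ S, ∀ t ∈ Icc (0 : ℝ) 1, x + w + t • v ∈ Z) :
    eLpNorm (S.indicator fun x => U (x + w + v) - U (x + w)) 2 volume ≤
      ‖v‖ₑ * eLpNorm (Z.indicator W) 2 volume := by
  have hWZ : Measurable (Z.indicator W) := h.measurable_grad.indicator hZ
  have hae := (measurePreserving_add_right volume w).quasiMeasurePreserving.ae (h.ae_sub_eq v)
  have h1 : eLpNorm (S.indicator fun x => U (x + w + v) - U (x + w)) 2 volume ≤
      eLpNorm (fun x => ∫ t in (0 : ℝ)..1, pairing v (Z.indicator W (x + w + t • v))) 2 volume := by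
    refine eLpNorm_mono_ae ?_
    filter_upwards [hae] with x hx
    by_cases hxS : x ∈ S
    · rw [indicator_of_mem hxS, hx (hS x hxS)]
      refine le_of_eq (congrArg _ (intervalIntegral.integral_congr fun t ht => ?_))
      rw [uIcc_of_le zero_le_one] at ht
      simp only [indicator_of_mem (hSZ x hxS t ht)]
    · simp [indicator_of_notMem hxS]
  refine h1.trans (eLpNorm_intervalIntegral_le ?_ fun t _ => ?_)
  · have : Measurable fun p : ℝ × RN N => Z.indicator W (p.2 + w + p.1 • v) :=
      hWZ.comp (by fun_prop)
    exact ((measurable_pairing v).comp this).stronglyMeasurable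
  · refine (eLpNorm_pairing_le v _).trans (le_of_eq ?_)
    rw [← eLpNorm_comp_add_right (Z.indicator W) hWZ.stronglyMeasurable (w + t • v)]
    simp only [add_assoc]

/-- Inside the segment formula `pairing v (W x)` is constant in `t`, so the error is an average of
translation differences of `W`. -/
theorem eLpNorm_difference_sub_pairing_le (h : IsSobolevPair Ω U W) (v : RN N) {c : ℝ≥0∞}
    (hc : ∀ k : RN N, ‖k‖ ≤ ‖v‖ → eLpNorm (fun x => W (x + k) - W x) 2 volume ≤ c) :
    eLpNorm ((segmentCore Ω v).indicator fun x => U (x + v) - U x - pairing v (W x)) 2 volume ≤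
      ‖v‖ₑ * c := by
  have hae2 := integrable_prod_translate (integrable_pairing h.integrable_grad v)
    ((measurable_pairing v).comp h.measurable_grad) v
  have hae3 : ∀ᵐ x : RN N, Integrable (fun t : ℝ => pairing v (W (x + t • v)))
      (volume.restrict (Ioc (0 : ℝ) 1)) := hae2.prod_left_ae
  have h1 : eLpNorm ((segmentCore Ω v).indicator fun x => U (x + v) - U x - pairing v (W x)) 2
      volume ≤ eLpNorm (fun x => ∫ t in (0 : ℝ)..1, pairing v (W (x + t • v) - W x)) 2 volume := by
    refine eLpNorm_mono_ae ?_
    filter_upwards [h.ae_sub_eq v, hae3] with x hx hi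
    by_cases hxS : x ∈ segmentCore Ω v
    · rw [indicator_of_mem hxS, hx hxS]
      simp_rw [pairing_sub_right]
      rw [intervalIntegral.integral_sub _ (by simp)]
      · simp
      · rwa [intervalIntegrable_iff_integrableOn_Ioc_of_le zero_le_one]
    · simp [indicator_of_notMem hxS]
  refine h1.trans (eLpNorm_intervalIntegral_le ?_ fun t ht => ?_)
  · have : Measurable fun p : ℝ × RN N => W (p.2 + p.1 • v) - W p.2 :=
      (h.measurable_grad.comp (by fun_prop)).sub (h.measurable_grad.comp measurable_snd)
    exact ((measurable_pairing v).comp this).stronglyMeasurable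
  · refine (eLpNorm_pairing_le v _).trans ?_
    gcongr
    refine hc _ ?_
    rw [norm_smul, Real.norm_of_nonneg ht.1.le]
    exact mul_le_of_le_one_left (norm_nonneg _) ht.2

theorem isSmall_difference_sub_pairing (h : IsSobolevPair Ω U W) :
    IsSmall fun v => eLpNorm
      ((segmentCore Ω v).indicator fun x => U (x + v) - U x - pairing v (W x)) 2 volume := by
  intro ε hε
  have ht := (tendsto_eLpNorm_translate_sub h.memLp_grad).eventually (Iic_mem_nhds hε.bot_lt)
  obtain ⟨δ, hδ, H⟩ := Metric.eventually_nhds_iff_ball.mp ht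
  filter_upwards [Metric.ball_mem_nhds (0 : RN N) hδ] with v hv
  rw [mul_comm]
  refine h.eLpNorm_difference_sub_pairing_le v fun k hk => H k ?_
  rw [mem_ball_zero_iff] at hv ⊢
  exact hk.trans_lt hv

/-- The increment telescopes along the three sides of the detour, whose lengths `C‖h‖`, `‖h‖`,
`C‖h‖` add up to the factor `2C + 1`. -/
theorem eLpNorm_detour_le (hs : IsSobolevPair Ω U W) {S : Set (RN N)} (hSm : MeasurableSet S)
    {h v : RN N} {C : ℝ} (hC : 0 ≤ C) (hv : ‖v‖ = C * ‖h‖) (hS : S ⊆ crossing Ω h)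
    (h1 : ∀ x ∈ S, x ∈ segmentCore Ω v ∧ x + h ∈ segmentCore Ω v ∧ x + v ∈ segmentCore Ω h) :
    eLpNorm (S.indicator fun x => U (x + h) - U x) 2 volume ≤
      ‖h‖ₑ * (ENNReal.ofReal (2 * C + 1) *
        eLpNorm ((boundaryLayer Ω ((C + 2) * ‖h‖)).indicator W) 2 volume) := by
  set Z := boundaryLayer Ω ((C + 2) * ‖h‖)
  have hZ : MeasurableSet Z := measurableSet_boundaryLayer hs.isOpen _
  -- Points of the detour are within `(C + 1)‖h‖` of `x`, and the direct segment has a point off `Ω`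
  -- within `‖h‖` of `x`; hence the layer width `(C + 2)‖h‖`.
  have hnear : ∀ x ∈ S, ∀ y : RN N, x + y ∈ Ω → ‖y‖ ≤ (C + 1) * ‖h‖ → x + y ∈ Z := by
    intro x hx y hy hyn
    have hx' : ∃ t ∈ Icc (0 : ℝ) 1, x + t • h ∉ Ω := by
      simpa [segmentCore, and_assoc] using (hS hx).2.2
    obtain ⟨t, ht, hty⟩ := hx'
    refine mem_boundaryLayer hy hty ?_
    have : ‖t • h‖ ≤ ‖h‖ := by
      rw [norm_smul, Real.norm_of_nonneg ht.1]
      exact mul_le_of_le_one_left (norm_nonneg _) ht.2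
    rw [dist_add_left, dist_eq_norm]
    calc ‖y - t • h‖ ≤ ‖y‖ + ‖t • h‖ := norm_sub_le _ _
      _ ≤ (C + 2) * ‖h‖ := by linarith
  have hsm (k : RN N) (t : ℝ) (ht : t ∈ Icc (0 : ℝ) 1) : ‖t • k‖ ≤ ‖k‖ := by
    rw [norm_smul, Real.norm_of_nonneg ht.1]
    exact mul_le_of_le_one_left (norm_nonneg _) ht.2
  have hh := norm_nonneg h
  have b1 := hs.eLpNorm_difference_le (S := S) hZ v 0 (fun x hx => by simpa using (h1 x hx).1)
    fun x hx t ht => by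
      rw [add_zero]
      exact hnear x hx _ ((h1 x hx).1 t ht) ((hsm v t ht).trans (by rw [hv]; nlinarith))
  have b2 := hs.eLpNorm_difference_le (S := S) hZ h v (fun x hx => (h1 x hx).2.2)
    fun x hx t ht => by
      have := (h1 x hx).2.2 t ht
      rw [add_assoc] at this ⊢
      refine hnear x hx _ this ((norm_add_le _ _).trans ?_)
      have := hsm h t ht
      rw [hv]
      linarith
  have b3 := hs.eLpNorm_difference_le (S := S) hZ v h (fun x hx => (h1 x hx).2.1)
    fun x hx t ht => by
      have := (h1 x hx).2.1 t ht
      rw [add_assoc] at this ⊢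
      refine hnear x hx _ this ((norm_add_le _ _).trans ?_)
      have := hsm v t ht
      linarith
  have hUm (k : RN N) : Measurable fun x => U (x + k) := hs.measurable_fun.comp (by fun_prop)
  have hm (w k : RN N) : AEStronglyMeasurable
      (S.indicator fun x => U (x + w + k) - U (x + w)) volume := by
    refine (Measurable.indicator ?_ hSm).aestronglyMeasurable
    simp_rw [add_assoc]
    exact (hUm _).sub (hUm _)
  have hsplit : (S.indicator fun x => U (x + h) - U x) =
      (S.indicator fun x => U (x + 0 + v) - U (x + 0)) +
        (S.indicator fun x => U (x + v + h) - U (x + v)) -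
        (S.indicator fun x => U (x + h + v) - U (x + h)) := by
    ext x
    by_cases hx : x ∈ S
    · simp only [Pi.sub_apply, Pi.add_apply, indicator_of_mem hx, add_zero]
      rw [add_right_comm x v h]
      ring
    · simp [indicator_of_notMem hx]
  have hve : ‖v‖ₑ = ENNReal.ofReal C * ‖h‖ₑ := by
    rw [← ofReal_norm, hv, ENNReal.ofReal_mul hC, ofReal_norm]
  rw [hsplit]
  calc _ ≤ eLpNorm _ 2 volume + eLpNorm _ 2 volume :=
        eLpNorm_sub_le ((hm 0 v).add (hm v h)) (hm h v) (by norm_num)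
    _ ≤ (eLpNorm _ 2 volume + eLpNorm _ 2 volume) + eLpNorm _ 2 volume := by
        gcongr
        exact eLpNorm_add_le (hm 0 v) (hm v h) (by norm_num)
    _ ≤ (‖v‖ₑ * eLpNorm (Z.indicator W) 2 volume + ‖h‖ₑ * eLpNorm (Z.indicator W) 2 volume) +
        ‖v‖ₑ * eLpNorm (Z.indicator W) 2 volume := by gcongr
    _ = _ := by
      rw [hve, ENNReal.ofReal_add (by positivity) zero_le_one, ENNReal.ofReal_mul zero_le_two]
      simp only [ENNReal.ofReal_one, ENNReal.ofReal_ofNat]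
      ring

theorem isSmall_crossing (hs : IsSobolevPair Ω U W) (hlip : HasLipschitzBoundary Ω) :
    IsSmall fun h => eLpNorm ((crossing Ω h).indicator fun x => U (x + h) - U x) 2 volume := by
  choose! ρ hρ C hC ν hν H using fun x₀ (hx₀ : x₀ ∈ frontier Ω) => hlip.exists_detour hx₀
  have hcomp : IsCompact (frontier Ω) :=
    hs.isBounded.isCompact_closure.of_isClosed_subset isClosed_frontier frontier_subset_closure
  -- Half radii: a point at distance at most `‖h‖ < ρ / 2` from a covered frontier point still lies
  -- in the full ball of that chart.
  obtain ⟨t, htf, htc⟩ := hcomp.elim_nhds_subcover (fun x => Metric.ball x (ρ x / 2))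
    fun x hx => Metric.ball_mem_nhds x (half_pos (hρ x hx))
  have hsum : IsSmall fun h => ∑ i ∈ t, eLpNorm
      ((crossing Ω h ∩ Metric.ball i (ρ i)).indicator fun x => U (x + h) - U x) 2 volume := by
    refine isSmall_sum t fun i hi => ?_
    refine isSmall_of_tendsto (tendsto_const_mul_zero (C := ENNReal.ofReal (2 * C i + 1))
      ENNReal.ofReal_ne_top (tendsto_eLpNorm_boundaryLayer_norm hs.isOpen hs.isBounded
        hs.memLp_grad (C i + 2))) ?_
    filter_upwards [Metric.ball_mem_nhds (0 : RN N) (hρ i (htf i hi))] with h hh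
    refine hs.eLpNorm_detour_le (v := (C i * ‖h‖) • ν i)
      ((measurableSet_crossing hs.isOpen h).inter measurableSet_ball) (hC i (htf i hi)) ?_
      inter_subset_left fun x hx => ?_
    · rw [norm_smul, hν i (htf i hi), mul_one, Real.norm_of_nonneg]
      exact mul_nonneg (hC i (htf i hi)) (norm_nonneg _)
    · exact H i (htf i hi) x hx.2 h (by simpa using hh) hx.1.1 hx.1.2.1
  refine hsum.mono ?_
  have hsmall : ∀ᶠ h : RN N in 𝓝 0, ∀ i ∈ t, ‖h‖ < ρ i / 2 := by
    rw [Filter.eventually_all_finset]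
    intro i hi
    filter_upwards [Metric.ball_mem_nhds (0 : RN N) (half_pos (hρ i (htf i hi)))] with h hh
    simpa using hh
  filter_upwards [hsmall] with h hh
  refine eLpNorm_indicator_le_sum ?_ (measurableSet_crossing hs.isOpen h) t
    (fun _ _ => measurableSet_ball) ?_
  · exact ((hs.measurable_fun.comp (by fun_prop)).sub hs.measurable_fun).stronglyMeasurable
  · intro x hx
    obtain ⟨z, hz, hxz⟩ := exists_frontier_dist_le hx.1 hx.2.2
    obtain ⟨i, hi, hzi⟩ := mem_iUnion₂.mp (htc hz)
    refine mem_iUnion₂.mpr ⟨i, hi, ?_⟩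
    rw [Metric.mem_ball] at hzi ⊢
    have := hh i hi
    linarith [dist_triangle x z i]

end IsSobolevPair

/-! ### First order expansion of the magnetic difference. -/

section SmallNorm

theorem IsSmall.eLpNorm_add {f g : RN N → RN N → ℝ}
    (hf : IsSmall fun h => eLpNorm (f h) 2 volume) (hg : IsSmall fun h => eLpNorm (g h) 2 volume)
    (hfm : ∀ h, Measurable (f h)) (hgm : ∀ h, Measurable (g h)) :
    IsSmall fun h => eLpNorm (fun x => f h x + g h x) 2 volume :=
  (hf.add hg).mono (Eventually.of_forall fun h =>
    MeasureTheory.eLpNorm_add_le (hfm h).aestronglyMeasurable (hgm h).aestronglyMeasurable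
      (by norm_num))

theorem isSmall_norm_mul {F : Type*} [NormedAddCommGroup F] {K : ℝ} (hK : 0 ≤ K)
    {f : RN N → RN N → F} (hf : Tendsto (fun h => eLpNorm (f h) 2 volume) (𝓝 0) (𝓝 0)) :
    IsSmall fun h => eLpNorm (fun x => K * ‖h‖ * ‖f h x‖) 2 volume := by
  refine isSmall_of_tendsto (tendsto_const_mul_zero (C := ENNReal.ofReal K)
    ENNReal.ofReal_ne_top hf) (Eventually.of_forall fun h => ?_)
  have := eLpNorm_le_mul_eLpNorm_of_ae_le_mul (μ := volume) (f := fun x => K * ‖h‖ * ‖f h x‖)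
    (g := f h) (c := K * ‖h‖) (Eventually.of_forall fun x => by
      rw [Real.norm_of_nonneg (by positivity)]) 2
  rw [ENNReal.ofReal_mul hK, ofReal_norm] at this
  exact this.trans (le_of_eq (by ring))

theorem tendsto_eLpNorm_translate_sub_half {U : RN N → ℂ} (hU : Measurable U)
    (h2 : MemLp U 2 volume) :
    Tendsto (fun h : RN N => eLpNorm (fun x => U (x + h) - U (x + (2⁻¹ : ℝ) • h)) 2 volume)
      (𝓝 0) (𝓝 0) := by
  have hc : Continuous fun h : RN N => (2⁻¹ : ℝ) • h := by fun_prop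
  have h0 := (tendsto_eLpNorm_translate_sub h2).comp (hc.tendsto' 0 0 (by simp))
  refine h0.congr fun h => ?_
  have hm : Measurable fun x => U (x + (2⁻¹ : ℝ) • h) - U x :=
    (hU.comp (by fun_prop)).sub hU
  simp only [Function.comp_apply]
  rw [← eLpNorm_comp_add_right _ hm.stronglyMeasurable ((2⁻¹ : ℝ) • h)]
  refine congrArg (fun f => eLpNorm f 2 volume) (funext fun x => ?_)
  have : x + (2⁻¹ : ℝ) • h + (2⁻¹ : ℝ) • h = x + h := by module
  rw [this]

end SmallNorm

/-- The complex vector field `A U`. -/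
def potentialTerm (A : RN N → RN N) (U : RN N → ℂ) (x : RN N) : CN N :=
  WithLp.toLp 2 fun j => (A x j : ℂ) * U x

theorem pairing_potentialTerm (A : RN N → RN N) (U : RN N → ℂ) (h x : RN N) :
    pairing h (potentialTerm A U x) = (inner ℝ h (A x) : ℝ) * U x := by
  simp [pairing, potentialTerm, PiLp.inner_apply, Finset.sum_mul, mul_assoc, mul_left_comm]

theorem norm_potentialTerm (A : RN N → RN N) (U : RN N → ℂ) (x : RN N) :
    ‖potentialTerm A U x‖ = ‖A x‖ * ‖U x‖ := by
  have : potentialTerm A U x = U x • (WithLp.toLp 2 fun j => (A x j : ℂ) : CN N) := by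
    ext j; simp [potentialTerm, mul_comm]
  rw [this, norm_smul, mul_comm]
  congr 1
  simp [EuclideanSpace.norm_eq]

theorem measurable_potentialTerm {A : RN N → RN N} (hA : Measurable A) {U : RN N → ℂ}
    (hU : Measurable U) : Measurable (potentialTerm A U) := by
  refine (PiLp.continuous_toLp 2 _).measurable.comp (measurable_pi_lambda _ fun j => ?_)
  have : Measurable fun x => A x j := (EuclideanSpace.proj (𝕜 := ℝ) j).continuous.measurable.comp hA
  exact (Complex.measurable_ofReal.comp this).mul hU

theorem memLp_potentialTerm {A : RN N → RN N} (hA : Measurable A) {U : RN N → ℂ}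
    (hU : Measurable U) (h2 : MemLp U 2 volume) {M : ℝ} (hM : ∀ x, ‖A x‖ ≤ M) :
    MemLp (potentialTerm A U) 2 volume := by
  refine h2.of_le_mul (c := M) (measurable_potentialTerm hA hU).aestronglyMeasurable
    (Eventually.of_forall fun x => ?_)
  rw [norm_potentialTerm]
  gcongr
  exact hM x

theorem magneticGradient_eq (A : RN N → RN N) (U : RN N → ℂ) (W : RN N → CN N) :
    magneticGradient A U W = W - Complex.I • potentialTerm A U := by
  ext x j
  simp [magneticGradient, potentialTerm, mul_assoc]

theorem pairing_magneticGradient (A : RN N → RN N) (U : RN N → ℂ) (W : RN N → CN N)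
    (h x : RN N) : pairing h (magneticGradient A U W x) =
      pairing h (W x) - Complex.I * pairing h (potentialTerm A U x) := by
  rw [magneticGradient_eq, Pi.sub_apply, pairing_sub_right]
  congr 1
  simp [pairing, Finset.mul_sum, mul_left_comm]

/-- `u(x) - e^{i(x-y)·A((x+y)/2)} u(y)` at `y = x + h`, restricted to `x, y ∈ Ω`. -/
noncomputable def magneticDifference (Ω : Set (RN N)) (A : RN N → RN N) (U : RN N → ℂ) (h : RN N) :
    RN N → ℂ :=
  {x | x ∈ Ω ∧ x + h ∈ Ω}.indicator fun x =>
    U x - Complex.exp (Complex.I * ((inner ℝ (-h) (A (x + (2⁻¹ : ℝ) • h)) : ℝ) : ℂ)) * U (x + h)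

theorem norm_exp_I_sub_one_sub_le {a : ℝ} (ha : |a| ≤ 1) :
    ‖1 - Complex.exp (Complex.I * ((-a : ℝ) : ℂ)) - Complex.I * a‖ ≤ |a| ^ 2 := by
  have hn : ‖Complex.I * ((-a : ℝ) : ℂ)‖ = |a| := by
    rw [norm_mul, Complex.norm_I, one_mul, Complex.norm_real, norm_neg, Real.norm_eq_abs]
  have h := Complex.norm_exp_sub_one_sub_id_le (x := Complex.I * ((-a : ℝ) : ℂ)) (by rwa [hn])
  rw [hn, ← norm_neg] at h
  refine le_trans (le_of_eq (congrArg _ ?_)) h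
  push_cast
  ring

namespace IsSobolevPair

variable {Ω : Set (RN N)} {U : RN N → ℂ} {W : RN N → CN N}

/-- The terms are, in order: the Taylor error of `U` along good segments, the quadratic remainder of
the phase, the shift of `U` to the midpoint, the shift of `A U` from the midpoint to `x`, the
increment over crossing pairs, the phase over crossing pairs, and `h·V` where the segment leaves
`Ω`. All but the first and fifth have the shape `K‖h‖‖f‖` with `f → 0` in L²; for this one factor
`‖h‖` of the second is kept inside `f`. -/
theorem norm_difference_add_pairing_le (hs : IsSobolevPair Ω U W) {A : RN N → RN N} {M : ℝ}
    (hM0 : 0 ≤ M) (hM : ∀ x, ‖A x‖ ≤ M) {h : RN N} (hh : M * ‖h‖ ≤ 1) (x : RN N) :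
    ‖magneticDifference Ω A U h x + pairing h (magneticGradient A U W x)‖ ≤
      ‖(segmentCore Ω h).indicator (fun x => U (x + h) - U x - pairing h (W x)) x‖ +
      M ^ 2 * ‖h‖ * ‖‖h‖ • U (x + h)‖ +
      M * ‖h‖ * ‖U (x + h) - U (x + (2⁻¹ : ℝ) • h)‖ +
      1 * ‖h‖ * ‖potentialTerm A U (x + (2⁻¹ : ℝ) • h) - potentialTerm A U x‖ +
      ‖(crossing Ω h).indicator (fun x => U (x + h) - U x) x‖ +
      M * ‖h‖ * ‖(boundaryLayer Ω (2 * ‖h‖)).indicator U (x + h)‖ +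
      1 * ‖h‖ * ‖(boundaryLayer Ω (2 * ‖h‖)).indicator (magneticGradient A U W) x‖ := by
  set a : ℝ := inner ℝ h (A (x + (2⁻¹ : ℝ) • h)) with ha
  have ha1 : |a| ≤ M * ‖h‖ := by
    calc |a| ≤ ‖h‖ * ‖A (x + (2⁻¹ : ℝ) • h)‖ := abs_real_inner_le_norm _ _
      _ ≤ ‖h‖ * M := by gcongr; exact hM _
      _ = _ := mul_comm _ _
  have hneg : (inner ℝ (-h) (A (x + (2⁻¹ : ℝ) • h)) : ℝ) = -a := inner_neg_left _ _
  by_cases hS : x ∈ segmentCore Ω h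
  · have hx : x ∈ Ω := by simpa using hS 0 (by simp)
    have hxh : x + h ∈ Ω := by simpa using hS 1 (by simp)
    have hid : magneticDifference Ω A U h x + pairing h (magneticGradient A U W x) =
        -(U (x + h) - U x - pairing h (W x)) +
        (1 - Complex.exp (Complex.I * ((-a : ℝ) : ℂ)) - Complex.I * a) * U (x + h) +
        Complex.I * (a * (U (x + h) - U (x + (2⁻¹ : ℝ) • h))) +
        Complex.I * pairing h (potentialTerm A U (x + (2⁻¹ : ℝ) • h) - potentialTerm A U x) := by
      rw [pairing_magneticGradient, magneticDifference,
        indicator_of_mem (show x ∈ {x | x ∈ Ω ∧ x + h ∈ Ω} from ⟨hx, hxh⟩), pairing_sub_right,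
        pairing_potentialTerm A U h (x + (2⁻¹ : ℝ) • h), hneg, ← ha]
      ring
    rw [hid, indicator_of_mem hS]
    have n2 : ‖(1 - Complex.exp (Complex.I * ((-a : ℝ) : ℂ)) - Complex.I * a) * U (x + h)‖ ≤
        M ^ 2 * ‖h‖ * ‖‖h‖ • U (x + h)‖ := by
      rw [norm_mul, norm_smul, norm_norm]
      calc _ ≤ (M * ‖h‖) ^ 2 * ‖U (x + h)‖ := by
            gcongr
            exact (norm_exp_I_sub_one_sub_le (ha1.trans hh)).trans (by gcongr)
        _ = _ := by ring
    have n3 : ‖Complex.I * (a * (U (x + h) - U (x + (2⁻¹ : ℝ) • h)))‖ ≤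
        M * ‖h‖ * ‖U (x + h) - U (x + (2⁻¹ : ℝ) • h)‖ := by
      rw [norm_mul, norm_mul, Complex.norm_I, one_mul, Complex.norm_real, Real.norm_eq_abs]
      gcongr
    have n4 : ‖Complex.I *
        pairing h (potentialTerm A U (x + (2⁻¹ : ℝ) • h) - potentialTerm A U x)‖ ≤
        1 * ‖h‖ * ‖potentialTerm A U (x + (2⁻¹ : ℝ) • h) - potentialTerm A U x‖ := by
      rw [norm_mul, Complex.norm_I, one_mul, one_mul]
      exact norm_pairing_le _ _
    have n5 : 0 ≤ ‖(crossing Ω h).indicator (fun x => U (x + h) - U x) x‖ +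
      M * ‖h‖ * ‖(boundaryLayer Ω (2 * ‖h‖)).indicator U (x + h)‖ +
      1 * ‖h‖ * ‖(boundaryLayer Ω (2 * ‖h‖)).indicator (magneticGradient A U W) x‖ := by
      positivity
    refine (norm_add₄_le).trans ?_
    rw [norm_neg]
    linarith
  · have hp (T : Set (RN N)) (f : RN N → ℂ) (y : RN N) : 0 ≤ ‖T.indicator f y‖ := norm_nonneg _
    have hV : ‖pairing h (magneticGradient A U W x)‖ ≤
        1 * ‖h‖ * ‖(boundaryLayer Ω (2 * ‖h‖)).indicator (magneticGradient A U W) x‖ := by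
      by_cases hx : x ∈ Ω
      · have hx' : ∃ t ∈ Icc (0 : ℝ) 1, x + t • h ∉ Ω := by
          simpa [segmentCore, and_assoc] using hS
        obtain ⟨t, ht, hty⟩ := hx'
        have hl : x ∈ boundaryLayer Ω (2 * ‖h‖) := by
          refine mem_boundaryLayer hx hty ?_
          rw [dist_self_add_right, norm_smul, Real.norm_of_nonneg ht.1]
          have := norm_nonneg h
          nlinarith [ht.2]
        rw [indicator_of_mem hl, one_mul]
        exact norm_pairing_le _ _
      · have : magneticGradient A U W x = 0 := by
          ext j
          simp [magneticGradient, hs.fun_eq_zero x hx, hs.grad_eq_zero x hx]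
        rw [this]
        simp only [pairing, PiLp.zero_apply, mul_zero, Finset.sum_const_zero, norm_zero]
        positivity
    have hQ : ‖magneticDifference Ω A U h x‖ ≤
        ‖(crossing Ω h).indicator (fun x => U (x + h) - U x) x‖ +
        M * ‖h‖ * ‖(boundaryLayer Ω (2 * ‖h‖)).indicator U (x + h)‖ := by
      by_cases hG : x ∈ Ω ∧ x + h ∈ Ω
      · have hx' : ∃ t ∈ Icc (0 : ℝ) 1, x + t • h ∉ Ω := by
          simpa [segmentCore, and_assoc] using hS
        obtain ⟨t, ht, hty⟩ := hx'
        have hl : x + h ∈ boundaryLayer Ω (2 * ‖h‖) := by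
          refine mem_boundaryLayer hG.2 hty ?_
          rw [dist_add_left, dist_eq_norm]
          refine (norm_sub_le _ _).trans ?_
          rw [norm_smul, Real.norm_of_nonneg ht.1]
          have := norm_nonneg h
          nlinarith [ht.2]
        rw [indicator_of_mem hl, indicator_of_mem (show x ∈ crossing Ω h from ⟨hG.1, hG.2, hS⟩),
          magneticDifference, indicator_of_mem (show x ∈ {x | x ∈ Ω ∧ x + h ∈ Ω} from hG), hneg]
        have : U x - Complex.exp (Complex.I * ((-a : ℝ) : ℂ)) * U (x + h) =
            -(U (x + h) - U x) - (Complex.exp (Complex.I * ((-a : ℝ) : ℂ)) - 1) * U (x + h) := by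
          ring
        rw [this]
        refine (norm_sub_le _ _).trans ?_
        rw [norm_neg, norm_mul]
        gcongr
        refine Real.norm_exp_I_mul_ofReal_sub_one_le.trans ?_
        rwa [norm_neg]
      · rw [magneticDifference, indicator_of_notMem (by exact hG), norm_zero]
        positivity
    have n1 : 0 ≤ M ^ 2 * ‖h‖ * ‖‖h‖ • U (x + h)‖ +
      M * ‖h‖ * ‖U (x + h) - U (x + (2⁻¹ : ℝ) • h)‖ +
      1 * ‖h‖ * ‖potentialTerm A U (x + (2⁻¹ : ℝ) • h) - potentialTerm A U x‖ := by positivity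
    have n2 := hp (segmentCore Ω h) (fun x => U (x + h) - U x - pairing h (W x)) x
    refine (norm_add_le _ _).trans ?_
    linarith

theorem measurable_magneticGradient (hs : IsSobolevPair Ω U W) {A : RN N → RN N}
    (hA : Measurable A) : Measurable (magneticGradient A U W) := by
  rw [magneticGradient_eq]
  exact hs.measurable_grad.sub ((measurable_potentialTerm hA hs.measurable_fun).const_smul _)

theorem memLp_magneticGradient (hs : IsSobolevPair Ω U W) {A : RN N → RN N}
    (hA : Measurable A) {M : ℝ} (hM : ∀ x, ‖A x‖ ≤ M) :
    MemLp (magneticGradient A U W) 2 volume := by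
  rw [magneticGradient_eq]
  exact hs.memLp_grad.sub
    ((memLp_potentialTerm hA hs.measurable_fun hs.memLp_fun hM).const_smul _)

/-- First order expansion of the magnetic difference in `L²`. -/
theorem isSmall_magneticDifference_add_pairing (hs : IsSobolevPair Ω U W)
    (hlip : HasLipschitzBoundary Ω) {A : RN N → RN N} (hA : Measurable A) {M : ℝ} (hM0 : 0 ≤ M)
    (hM : ∀ x, ‖A x‖ ≤ M) :
    IsSmall fun h => eLpNorm
      (fun x => magneticDifference Ω A U h x + pairing h (magneticGradient A U W x)) 2 volume := by
  have hUm (k : RN N) : Measurable fun x => U (x + k) := hs.measurable_fun.comp (by fun_prop)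
  have hBm := measurable_potentialTerm hA hs.measurable_fun
  have hB2 := memLp_potentialTerm hA hs.measurable_fun hs.memLp_fun hM
  have hBm' (k : RN N) : Measurable fun x => potentialTerm A U (x + k) := hBm.comp (by fun_prop)
  have hVm := hs.measurable_magneticGradient hA
  have hV2 := hs.memLp_magneticGradient hA hM
  have hlm (r : ℝ) : MeasurableSet (boundaryLayer Ω r) := measurableSet_boundaryLayer hs.isOpen r
  have m1 (h : RN N) : Measurable fun x => ‖(segmentCore Ω h).indicator
      (fun x => U (x + h) - U x - pairing h (W x)) x‖ :=
    ((((hUm h).sub hs.measurable_fun).sub ((measurable_pairing h).comp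
      hs.measurable_grad)).indicator (isOpen_segmentCore hs.isOpen h).measurableSet).norm
  have m2 (h : RN N) : Measurable fun x => M ^ 2 * ‖h‖ * ‖‖h‖ • U (x + h)‖ :=
    (Measurable.norm (f := fun x => ‖h‖ • U (x + h)) ((hUm h).const_smul ‖h‖)).const_mul _
  have m3 (h : RN N) : Measurable fun x =>
      M * ‖h‖ * ‖U (x + h) - U (x + (2⁻¹ : ℝ) • h)‖ := (((hUm h).sub (hUm _)).norm).const_mul _
  have m4 (h : RN N) : Measurable fun x => 1 * ‖h‖ *
      ‖potentialTerm A U (x + (2⁻¹ : ℝ) • h) - potentialTerm A U x‖ :=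
    (((hBm' _).sub hBm).norm).const_mul _
  have m5 (h : RN N) : Measurable fun x =>
      ‖(crossing Ω h).indicator (fun x => U (x + h) - U x) x‖ :=
    (((hUm h).sub hs.measurable_fun).indicator (measurableSet_crossing hs.isOpen h)).norm
  have m6 (h : RN N) : Measurable fun x =>
      M * ‖h‖ * ‖(boundaryLayer Ω (2 * ‖h‖)).indicator U (x + h)‖ :=
    (((hs.measurable_fun.indicator (hlm _)).comp (by fun_prop)).norm).const_mul _
  have m7 (h : RN N) : Measurable fun x =>
      1 * ‖h‖ * ‖(boundaryLayer Ω (2 * ‖h‖)).indicator (magneticGradient A U W) x‖ :=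
    ((hVm.indicator (hlm _)).norm).const_mul _
  have s1 : IsSmall fun h => eLpNorm (fun x => ‖(segmentCore Ω h).indicator
      (fun x => U (x + h) - U x - pairing h (W x)) x‖) 2 volume := by
    simp_rw [eLpNorm_norm]
    exact hs.isSmall_difference_sub_pairing
  have s2 : IsSmall fun h => eLpNorm (fun x => M ^ 2 * ‖h‖ * ‖‖h‖ • U (x + h)‖) 2 volume := by
    refine isSmall_norm_mul (by positivity) (f := fun h x => ‖h‖ • U (x + h)) ?_
    have h0 : Tendsto (fun h : RN N => eLpNorm U 2 volume * ‖h‖ₑ) (𝓝 0) (𝓝 0) :=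
      tendsto_const_mul_zero hs.memLp_fun.eLpNorm_ne_top
        ((continuous_enorm (E := RN N)).tendsto' 0 0 (by simp))
    refine h0.congr fun h => ?_
    have := eLpNorm_const_smul (μ := volume) ‖h‖ (fun x => U (x + h)) 2
    rw [eLpNorm_comp_add_right U hs.measurable_fun.stronglyMeasurable, enorm_norm] at this
    rw [mul_comm, ← this]
    rfl
  have s3 : IsSmall fun h => eLpNorm
      (fun x => M * ‖h‖ * ‖U (x + h) - U (x + (2⁻¹ : ℝ) • h)‖) 2 volume :=
    isSmall_norm_mul hM0 (f := fun h x => U (x + h) - U (x + (2⁻¹ : ℝ) • h))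
      (tendsto_eLpNorm_translate_sub_half hs.measurable_fun hs.memLp_fun)
  have s4 : IsSmall fun h => eLpNorm (fun x => 1 * ‖h‖ *
      ‖potentialTerm A U (x + (2⁻¹ : ℝ) • h) - potentialTerm A U x‖) 2 volume := by
    have hc : Continuous fun h : RN N => (2⁻¹ : ℝ) • h := by fun_prop
    exact isSmall_norm_mul zero_le_one
      (f := fun h x => potentialTerm A U (x + (2⁻¹ : ℝ) • h) - potentialTerm A U x)
      ((tendsto_eLpNorm_translate_sub hB2).comp (hc.tendsto' 0 0 (by simp)))
  have s5 : IsSmall fun h => eLpNorm (fun x =>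
      ‖(crossing Ω h).indicator (fun x => U (x + h) - U x) x‖) 2 volume := by
    simp_rw [eLpNorm_norm]
    exact hs.isSmall_crossing hlip
  have s6 : IsSmall fun h => eLpNorm (fun x =>
      M * ‖h‖ * ‖(boundaryLayer Ω (2 * ‖h‖)).indicator U (x + h)‖) 2 volume := by
    refine isSmall_norm_mul hM0 (f := fun h x => (boundaryLayer Ω (2 * ‖h‖)).indicator U (x + h)) ?_
    refine (tendsto_eLpNorm_boundaryLayer_norm hs.isOpen hs.isBounded hs.memLp_fun 2).congr
      fun h => ?_
    exact (eLpNorm_comp_add_right _ (hs.measurable_fun.indicator (hlm _)).stronglyMeasurable h).symm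
  have s7 : IsSmall fun h => eLpNorm (fun x =>
      1 * ‖h‖ * ‖(boundaryLayer Ω (2 * ‖h‖)).indicator (magneticGradient A U W) x‖) 2 volume :=
    isSmall_norm_mul zero_le_one
      (f := fun h x => (boundaryLayer Ω (2 * ‖h‖)).indicator (magneticGradient A U W) x)
      (tendsto_eLpNorm_boundaryLayer_norm hs.isOpen hs.isBounded hV2 2)
  have n2 (h : RN N) := (m1 h).add (m2 h)
  have n3 (h : RN N) := (n2 h).add (m3 h)
  have n4 (h : RN N) := (n3 h).add (m4 h)
  have n5 (h : RN N) := (n4 h).add (m5 h)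
  have n6 (h : RN N) := (n5 h).add (m6 h)
  have hsum := ((((((s1.eLpNorm_add s2 m1 m2).eLpNorm_add s3 n2 m3).eLpNorm_add s4 n3
    m4).eLpNorm_add s5 n4 m5).eLpNorm_add s6 n5 m6).eLpNorm_add s7 n6 m7)
  refine hsum.mono ?_
  have hc : Continuous fun h : RN N => M * ‖h‖ := by fun_prop
  filter_upwards [(hc.tendsto' 0 0 (by simp)).eventually (Iic_mem_nhds zero_lt_one)] with h hh
  exact eLpNorm_mono_real fun x => hs.norm_difference_add_pairing_le hM0 hM hh x

theorem measurable_magneticDifference_uncurry (hs : IsSobolevPair Ω U W) {A : RN N → RN N}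
    (hA : Measurable A) :
    Measurable fun p : RN N × RN N => magneticDifference Ω A U p.1 p.2 := by
  have hS : MeasurableSet {p : RN N × RN N | p.2 ∈ Ω ∧ p.2 + p.1 ∈ Ω} :=
    (hs.isOpen.measurableSet.preimage measurable_snd).inter
      (hs.isOpen.measurableSet.preimage (measurable_snd.add measurable_fst))
  have hA' : Measurable fun p : RN N × RN N => A (p.2 + (2⁻¹ : ℝ) • p.1) :=
    hA.comp (by fun_prop)
  have hf : Measurable fun p : RN N × RN N => U p.2 - Complex.exp (Complex.I *
      ((inner ℝ (-p.1) (A (p.2 + (2⁻¹ : ℝ) • p.1)) : ℝ) : ℂ)) * U (p.2 + p.1) := by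
    refine (hs.measurable_fun.comp measurable_snd).sub (Measurable.mul ?_
      (hs.measurable_fun.comp (measurable_snd.add measurable_fst)))
    exact Complex.measurable_exp.comp ((Complex.measurable_ofReal.comp
      (measurable_fst.neg.inner hA')).const_mul _)
  exact hf.indicator hS

theorem eventually_sq_le (hs : IsSobolevPair Ω U W)
    (hlip : HasLipschitzBoundary Ω) {A : RN N → RN N} (hA : Measurable A) {M : ℝ} (hM0 : 0 ≤ M)
    (hM : ∀ x, ‖A x‖ ≤ M) {ε : ℝ≥0∞} (hε : ε ≠ 0) :
    ∀ᶠ h in 𝓝 (0 : RN N),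
      eLpNorm (magneticDifference Ω A U h) 2 volume ^ 2 ≤
        eLpNorm (fun x => pairing h (magneticGradient A U W x)) 2 volume ^ 2 + ε * ‖h‖ₑ ^ 2 ∧
      eLpNorm (fun x => pairing h (magneticGradient A U W x)) 2 volume ^ 2 ≤
        eLpNorm (magneticDifference Ω A U h) 2 volume ^ 2 + ε * ‖h‖ₑ ^ 2 := by
  have hV := (hs.memLp_magneticGradient hA hM).eLpNorm_ne_top
  set c := eLpNorm (magneticGradient A U W) 2 volume with hc
  have hc3 : 2 * c + 3 ≠ ⊤ := by finiteness
  -- Squaring the triangle inequality gives errors `2cη + η²` and `2cη + 3η²`; since `η ≤ 1`, both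
  -- are at most `(2c + 3)η`.
  set η := min 1 (ε / (2 * c + 3)) with hη
  have hη0 : η ≠ 0 := by
    rw [hη]
    exact (lt_min one_pos (ENNReal.div_pos hε hc3)).ne'
  have hη1 : η ≤ 1 := min_le_left _ _
  have hηε : (2 * c + 3) * η ≤ ε :=
    (mul_le_mul_right (min_le_right _ _) _).trans ENNReal.mul_div_le
  filter_upwards [hs.isSmall_magneticDifference_add_pairing hlip hA hM0 hM η hη0] with h hh
  have hQm : AEStronglyMeasurable (magneticDifference Ω A U h) volume :=
    ((hs.measurable_magneticDifference_uncurry hA).comp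
      (measurable_const.prodMk measurable_id)).aestronglyMeasurable
  have hpm : AEStronglyMeasurable (fun x => pairing h (magneticGradient A U W x)) volume :=
    ((measurable_pairing h).comp (hs.measurable_magneticGradient hA)).aestronglyMeasurable
  have hb := eLpNorm_pairing_le h (magneticGradient A U W)
  rw [← hc] at hb
  set a := eLpNorm (magneticDifference Ω A U h) 2 volume
  set b := eLpNorm (fun x => pairing h (magneticGradient A U W x)) 2 volume
  set d := eLpNorm
    (fun x => magneticDifference Ω A U h x + pairing h (magneticGradient A U W x)) 2 volume
  have h1 : a ≤ d + b := by
    have := eLpNorm_sub_le (p := 2) (hQm.add hpm) hpm (by norm_num)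
    rwa [add_sub_cancel_right] at this
  have h2 : b ≤ d + a := by
    have := eLpNorm_sub_le (p := 2) (hQm.add hpm) hQm (by norm_num)
    rwa [add_sub_cancel_left] at this
  have hηη : η ^ 2 ≤ η := by
    rw [sq]; exact mul_le_of_le_one_left' hη1
  constructor
  · calc a ^ 2 ≤ (η * ‖h‖ₑ + b) ^ 2 := by gcongr; exact h1.trans (by gcongr)
      _ = b ^ 2 + (2 * η * ‖h‖ₑ * b + η ^ 2 * ‖h‖ₑ ^ 2) := by ring
      _ ≤ b ^ 2 + (2 * η * ‖h‖ₑ * (‖h‖ₑ * c) + η * ‖h‖ₑ ^ 2) := by gcongr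
      _ = b ^ 2 + ((2 * c + 1) * η) * ‖h‖ₑ ^ 2 := by ring
      _ ≤ b ^ 2 + ((2 * c + 3) * η) * ‖h‖ₑ ^ 2 := by gcongr; norm_num
      _ ≤ _ := by gcongr
  · have ha : a ≤ (c + η) * ‖h‖ₑ := by
      calc a ≤ η * ‖h‖ₑ + ‖h‖ₑ * c := h1.trans (by gcongr)
        _ = _ := by ring
    calc b ^ 2 ≤ (η * ‖h‖ₑ + a) ^ 2 := by gcongr; exact h2.trans (by gcongr)
      _ = a ^ 2 + (2 * η * ‖h‖ₑ * a + η ^ 2 * ‖h‖ₑ ^ 2) := by ring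
      _ ≤ a ^ 2 + (2 * η * ‖h‖ₑ * ((c + η) * ‖h‖ₑ) + η ^ 2 * ‖h‖ₑ ^ 2) := by gcongr
      _ = a ^ 2 + (2 * c * η + 3 * η ^ 2) * ‖h‖ₑ ^ 2 := by ring
      _ ≤ a ^ 2 + (2 * c * η + 3 * η) * ‖h‖ₑ ^ 2 := by gcongr
      _ = a ^ 2 + ((2 * c + 3) * η) * ‖h‖ₑ ^ 2 := by ring
      _ ≤ _ := by gcongr

end IsSobolevPair

/-! ### Second moments of radial weights and the constant `K_N`. -/

section Radial

/-- The second moment in direction `v` of the radial weight `g`. -/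
noncomputable def radialMoment (g : ℝ → ℝ≥0∞) (v : RN N) : ℝ≥0∞ :=
  ∫⁻ h : RN N, g ‖h‖ * ENNReal.ofReal (inner ℝ h v ^ 2)

/-- The reflection in the hyperplane orthogonal to `v - w` exchanges the two vectors and preserves
both the norm and Lebesgue measure. -/
theorem radialMoment_eq_of_norm_eq (g : ℝ → ℝ≥0∞) {v w : RN N} (h : ‖v‖ = ‖w‖) :
    radialMoment g v = radialMoment g w := by
  set R := (Submodule.span ℝ {v - w})ᗮ.reflection with hR
  have hRv : R v = w := Submodule.reflection_sub h
  have hmp := R.measurePreserving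
  refine Eq.trans ?_ (hmp.lintegral_comp_emb R.toHomeomorph.measurableEmbedding
    fun h => g ‖h‖ * ENNReal.ofReal (inner ℝ h w ^ 2))
  refine lintegral_congr fun x => ?_
  rw [R.norm_map, ← hRv, R.inner_map_map]

theorem radialMoment_eq_mul (g : ℝ → ℝ≥0∞) {e : RN N} (he : ‖e‖ = 1) (v : RN N) :
    radialMoment g v = ENNReal.ofReal (‖v‖ ^ 2) * radialMoment g e := by
  have h : ‖v‖ = ‖‖v‖ • e‖ := by rw [norm_smul, he, norm_norm, mul_one]
  rw [radialMoment_eq_of_norm_eq g h, radialMoment, radialMoment,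
    ← lintegral_const_mul' _ _ ENNReal.ofReal_ne_top]
  refine lintegral_congr fun x => ?_
  rw [real_inner_smul_right, mul_pow, ENNReal.ofReal_mul (by positivity)]
  ring

theorem enorm_pairing_sq (h : RN N) (z : CN N) : ‖pairing h z‖ₑ ^ 2 =
    ENNReal.ofReal (inner ℝ h (WithLp.toLp 2 (fun j => (z j).re) : RN N) ^ 2) +
      ENNReal.ofReal (inner ℝ h (WithLp.toLp 2 (fun j => (z j).im) : RN N) ^ 2) := by
  have hre : (pairing h z).re = inner ℝ h (WithLp.toLp 2 (fun j => (z j).re) : RN N) := by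
    simp [pairing, PiLp.inner_apply, mul_comm]
  have him : (pairing h z).im = inner ℝ h (WithLp.toLp 2 (fun j => (z j).im) : RN N) := by
    simp [pairing, PiLp.inner_apply, mul_comm]
  rw [← hre, ← him, ← ENNReal.ofReal_add (sq_nonneg _) (sq_nonneg _), ← ofReal_norm,
    ← ENNReal.ofReal_pow (norm_nonneg _), ← Complex.normSq_eq_norm_sq, Complex.normSq_apply]
  ring_nf

theorem norm_sq_re_add_norm_sq_im (z : CN N) :
    ‖(WithLp.toLp 2 (fun j => (z j).re) : RN N)‖ ^ 2 +
      ‖(WithLp.toLp 2 (fun j => (z j).im) : RN N)‖ ^ 2 = ‖z‖ ^ 2 := by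
  rw [EuclideanSpace.norm_sq_eq, EuclideanSpace.norm_sq_eq, EuclideanSpace.norm_sq_eq,
    ← Finset.sum_add_distrib]
  refine Finset.sum_congr rfl fun j _ => ?_
  rw [← Complex.normSq_eq_norm_sq, Complex.normSq_apply]
  simp only [Real.norm_eq_abs, sq_abs]
  ring

/-- The real and imaginary parts of `z` are real vectors whose contributions add up, by homogeneity
of the moment. -/
theorem lintegral_radial_mul_pairing {g : ℝ → ℝ≥0∞} (hg : Measurable g) {e : RN N}
    (he : ‖e‖ = 1) (z : CN N) :
    ∫⁻ h : RN N, g ‖h‖ * ‖pairing h z‖ₑ ^ 2 = radialMoment g e * ‖z‖ₑ ^ 2 := by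
  simp_rw [enorm_pairing_sq, mul_add]
  rw [lintegral_add_left]
  · change radialMoment g _ + radialMoment g _ = _
    rw [radialMoment_eq_mul g he (WithLp.toLp 2 fun j => (z j).re),
      radialMoment_eq_mul g he (WithLp.toLp 2 fun j => (z j).im), ← add_mul,
      ← ENNReal.ofReal_add (by positivity) (by positivity), norm_sq_re_add_norm_sq_im,
      ENNReal.ofReal_pow (norm_nonneg _), ofReal_norm, mul_comm]
  · exact (hg.comp measurable_norm).mul
      ((measurable_id.inner_const).pow_const 2).ennreal_ofReal

/-- The `N` coordinate directions have equal moments. This controls the error `ε‖h‖²` in the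
concentration argument. -/
theorem lintegral_radial_mul_norm_sq {g : ℝ → ℝ≥0∞} (hg : Measurable g) {e : RN N}
    (he : ‖e‖ = 1) :
    ∫⁻ h : RN N, g ‖h‖ * ‖h‖ₑ ^ 2 = N * radialMoment g e := by
  have h1 (h : RN N) : g ‖h‖ * ‖h‖ₑ ^ 2 =
      ∑ j, g ‖h‖ * ENNReal.ofReal (inner ℝ h (EuclideanSpace.single j (1 : ℝ)) ^ 2) := by
    rw [← Finset.mul_sum, ← ENNReal.ofReal_sum_of_nonneg fun _ _ => sq_nonneg _, ← ofReal_norm,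
      ← ENNReal.ofReal_pow (norm_nonneg _), EuclideanSpace.norm_sq_eq]
    simp [EuclideanSpace.inner_single_right]
  simp_rw [h1]
  rw [lintegral_finsetSum]
  · have (j : Fin N) := radialMoment_eq_mul g he (EuclideanSpace.single j (1 : ℝ))
    simp only [PiLp.norm_single, norm_one, one_pow, ENNReal.ofReal_one, one_mul] at this
    simp only [radialMoment] at this ⊢
    simp [this]
  · exact fun j _ => (hg.comp measurable_norm).mul
      ((measurable_id.inner_const).pow_const 2).ennreal_ofReal

theorem radialMoment_eq_polar {g : ℝ → ℝ≥0∞} (hg : Measurable g) (e : RN N) :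
    radialMoment g e = ENNReal.ofReal (2 * bbmConstant e) *
      ∫⁻ r in Ioi (0 : ℝ), ENNReal.ofReal (r ^ (N - 1)) * (g r * ENNReal.ofReal (r ^ 2)) := by
  -- Polar coordinates are used on a nontrivial space; for `N = 0` both sides vanish.
  rcases Nat.eq_zero_or_pos N with rfl | hN
  · have he : e = 0 := Subsingleton.elim _ _
    simp [radialMoment, bbmConstant, he]
  have : Nontrivial (RN N) := by
    have : Nonempty (Fin N) := ⟨⟨0, hN⟩⟩
    infer_instance
  have hS : ENNReal.ofReal (2 * bbmConstant e) =
      ∫⁻ w : Metric.sphere (0 : RN N) 1, ENNReal.ofReal (inner ℝ (w : RN N) e ^ 2)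
        ∂((volume : Measure (RN N)).toSphere) := by
    have hc : Continuous fun w : Metric.sphere (0 : RN N) 1 => (inner ℝ (w : RN N) e : ℝ) ^ 2 := by
      fun_prop
    rw [← ofReal_integral_eq_lintegral_ofReal
      (hc.integrable_of_hasCompactSupport (HasCompactSupport.of_compactSpace _))
      (Eventually.of_forall fun w => sq_nonneg _), bbmConstant]
    congr 1
    rw [← mul_assoc]
    norm_num
  have hR : ∫⁻ r in Ioi (0 : ℝ), ENNReal.ofReal (r ^ (N - 1)) * (g r * ENNReal.ofReal (r ^ 2)) =
      ∫⁻ r : Ioi (0 : ℝ), g r * ENNReal.ofReal ((r : ℝ) ^ 2) ∂(Measure.volumeIoiPow (N - 1)) := by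
    rw [Measure.volumeIoiPow, lintegral_withDensity_eq_lintegral_mul]
    · simp only [Pi.mul_apply]
      rw [lintegral_subtype_comap measurableSet_Ioi
        (fun r : ℝ => ENNReal.ofReal (r ^ (N - 1)) * (g r * ENNReal.ofReal (r ^ 2)))]
    · exact (measurable_subtype_coe.pow_const _).ennreal_ofReal
    · exact (hg.comp measurable_subtype_coe).mul
        (measurable_subtype_coe.pow_const _).ennreal_ofReal
  have hmp := (volume : Measure (RN N)).measurePreserving_homeomorphUnitSphereProd
  rw [finrank_euclideanSpace_fin] at hmp
  rw [hS, hR, ← lintegral_prod_mul, ← hmp.lintegral_comp_emb (Homeomorph.measurableEmbedding _),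
    radialMoment, ← restrict_compl_singleton (μ := (volume : Measure (RN N))) 0,
    ← lintegral_subtype_comap (measurableSet_singleton _).compl]
  · rw [restrict_compl_singleton]
    refine lintegral_congr fun x => ?_
    have hx : ‖(x : RN N)‖ ≠ 0 := norm_ne_zero_iff.mpr x.2
    rw [homeomorphUnitSphereProd_apply_snd_coe, homeomorphUnitSphereProd_apply_fst_coe,
      real_inner_smul_left, mul_left_comm, ← ENNReal.ofReal_mul (by positivity)]
    congr 2
    field_simp
  · exact ((measurable_subtype_coe.inner_const).pow_const 2).ennreal_ofReal.aemeasurable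
  · exact ((hg.comp measurable_subtype_coe).mul
        (measurable_subtype_coe.pow_const _).ennreal_ofReal).aemeasurable

/-- The kernel `|h|^{-(N+2s)}` as a function of `r = |h|`. -/
noncomputable def kernel (N : ℕ) (s r : ℝ) : ℝ≥0∞ := ENNReal.ofReal (r ^ (-((N : ℝ) + 2 * s)))

theorem measurable_kernel (N : ℕ) (s : ℝ) : Measurable (kernel N s) :=
  (measurable_id.pow_const _).ennreal_ofReal

/-- The radial integrand is `r^{N-1} r^{-N-2s} r² = r^{1-2s}`, integrable at 0 since `s < 1`, with
integral `δ^{2-2s} / (2(1-s))`. The 2 cancels the one half in `bbmConstant`. -/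
theorem radialMoment_kernel {e : RN N} (he : ‖e‖ = 1) {s δ : ℝ} (hs : s < 1) (hδ : 0 < δ) :
    ENNReal.ofReal (1 - s) * radialMoment ((Iio δ).indicator (kernel N s)) e =
      ENNReal.ofReal (bbmConstant e * δ ^ (2 - 2 * s)) := by
  have hN : 0 < N := by
    rcases Nat.eq_zero_or_pos N with rfl | h
    · rw [Subsingleton.elim e 0, norm_zero] at he
      exact absurd he zero_ne_one
    · exact h
  have hb : 0 ≤ bbmConstant e := by unfold bbmConstant; positivity
  have hr : ∫⁻ r in Ioi (0 : ℝ), ENNReal.ofReal (r ^ (N - 1)) *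
      ((Iio δ).indicator (kernel N s) r * ENNReal.ofReal (r ^ 2)) =
      ENNReal.ofReal (δ ^ (2 - 2 * s) / (2 - 2 * s)) := by
    have hi := (intervalIntegral.intervalIntegrable_rpow' (a := 0) (b := δ)
      (show -1 < 1 - 2 * s by linarith))
    have h1 : ∫ r in (0 : ℝ)..δ, r ^ (1 - 2 * s) = δ ^ (2 - 2 * s) / (2 - 2 * s) := by
      rw [integral_rpow (Or.inl (by linarith))]
      have : 1 - 2 * s + 1 = 2 - 2 * s := by ring
      rw [this, Real.zero_rpow (by linarith), sub_zero]
    have h2 : ∀ r ∈ Ioi (0 : ℝ), ENNReal.ofReal (r ^ (N - 1)) *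
        ((Iio δ).indicator (kernel N s) r * ENNReal.ofReal (r ^ 2)) =
        (Iio δ).indicator (fun r => ENNReal.ofReal (r ^ (1 - 2 * s))) r := by
      intro r hr
      by_cases hrδ : r ∈ Iio δ
      · rw [indicator_of_mem hrδ, indicator_of_mem hrδ, kernel,
          ← ENNReal.ofReal_mul (Real.rpow_nonneg (le_of_lt hr) _),
          ← ENNReal.ofReal_mul (pow_nonneg (le_of_lt hr) _), ← Real.rpow_natCast r (N - 1),
          ← Real.rpow_natCast r 2, ← Real.rpow_add hr, ← Real.rpow_add hr, Nat.cast_sub hN]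
        congr 2
        push_cast
        ring
      · simp [indicator_of_notMem hrδ]
    rw [setLIntegral_congr_fun measurableSet_Ioi h2, lintegral_indicator measurableSet_Iio,
      Measure.restrict_restrict measurableSet_Iio, inter_comm, Ioi_inter_Iio,
      Measure.restrict_congr_set Ioo_ae_eq_Ioc, ← h1, intervalIntegral.integral_of_le hδ.le,
      ofReal_integral_eq_lintegral_ofReal hi.1]
    filter_upwards [ae_restrict_mem measurableSet_Ioc] with r hr
    exact Real.rpow_nonneg hr.1.le _
  rw [radialMoment_eq_polar ((measurable_kernel N s).indicator measurableSet_Iio), hr,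
    ← ENNReal.ofReal_mul (by positivity), ← ENNReal.ofReal_mul (by linarith)]
  congr 1
  have : 2 - 2 * s ≠ 0 := by linarith
  have : 1 - s ≠ 0 := by linarith
  field_simp

theorem tendsto_radialMoment_kernel {e : RN N} (he : ‖e‖ = 1) {δ : ℝ} (hδ : 0 < δ) :
    Tendsto (fun s => ENNReal.ofReal (1 - s) * radialMoment ((Iio δ).indicator (kernel N s)) e)
      (𝓝[<] 1) (𝓝 (ENNReal.ofReal (bbmConstant e))) := by
  have hc : Continuous fun s : ℝ => ENNReal.ofReal (bbmConstant e * δ ^ (2 - 2 * s)) := by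
    refine ENNReal.continuous_ofReal.comp (continuous_const.mul ?_)
    exact Continuous.rpow continuous_const (by fun_prop) fun _ => Or.inl hδ.ne'
  have h := (hc.tendsto' 1 (ENNReal.ofReal (bbmConstant e)) (by norm_num)).mono_left
    (nhdsWithin_le_nhds (s := Iio 1))
  refine h.congr' ?_
  filter_upwards [self_mem_nhdsWithin] with s hs
  exact (radialMoment_kernel he hs hδ).symm

end Radial

/-! ### Concentration of the kernels at the origin. -/

section Limit

/-- For `0 < s < 1` and `δ ≤ 1` the kernel off the ball is at most `δ^{-(N+2)}`, uniformly in `s`,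
so the factor `1 - s` wins. -/
theorem tendsto_far {F : RN N → ℝ≥0∞} (hF : ∫⁻ h, F h ≠ ⊤) {δ : ℝ} (hδ : 0 < δ) (hδ1 : δ ≤ 1) :
    Tendsto (fun s => ENNReal.ofReal (1 - s) *
      ∫⁻ h in (Metric.ball (0 : RN N) δ)ᶜ, kernel N s ‖h‖ * F h) (𝓝[<] 1) (𝓝 0) := by
  have hc : Continuous fun s : ℝ => ENNReal.ofReal (1 - s) :=
    ENNReal.continuous_ofReal.comp (by fun_prop)
  have h1 : Tendsto (fun s : ℝ => ENNReal.ofReal (1 - s)) (𝓝[<] 1) (𝓝 0) :=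
    (hc.tendsto' 1 0 (by simp)).mono_left nhdsWithin_le_nhds
  set C := ENNReal.ofReal (δ ^ (-((N : ℝ) + 2))) * ∫⁻ h, F h
  have hC : C ≠ ⊤ := ENNReal.mul_ne_top ENNReal.ofReal_ne_top hF
  refine tendsto_of_tendsto_of_tendsto_of_le_of_le' tendsto_const_nhds
    (tendsto_const_mul_zero hC h1) (Eventually.of_forall fun _ => bot_le) ?_
  filter_upwards [Ioo_mem_nhdsLT (show (0 : ℝ) < 1 by norm_num)] with s hs
  rw [mul_comm C]
  gcongr
  calc ∫⁻ h in (Metric.ball (0 : RN N) δ)ᶜ, kernel N s ‖h‖ * F h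
      ≤ ∫⁻ h in (Metric.ball (0 : RN N) δ)ᶜ, ENNReal.ofReal (δ ^ (-((N : ℝ) + 2))) * F h := by
        refine setLIntegral_mono' measurableSet_ball.compl fun h hh => ?_
        have hh' : δ ≤ ‖h‖ := by simpa using hh
        gcongr
        refine ENNReal.ofReal_le_ofReal ?_
        have hN : (0 : ℝ) ≤ N := N.cast_nonneg
        calc ‖h‖ ^ (-((N : ℝ) + 2 * s)) ≤ δ ^ (-((N : ℝ) + 2 * s)) :=
              Real.rpow_le_rpow_of_nonpos hδ hh' (by linarith [hs.1])
          _ ≤ δ ^ (-((N : ℝ) + 2)) :=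
              Real.rpow_le_rpow_of_exponent_ge hδ hδ1 (by linarith [hs.2])
    _ = ENNReal.ofReal (δ ^ (-((N : ℝ) + 2))) * ∫⁻ h in (Metric.ball (0 : RN N) δ)ᶜ, F h :=
        lintegral_const_mul' _ _ ENNReal.ofReal_ne_top
    _ ≤ C := by
        exact mul_le_mul_right (setLIntegral_le_lintegral _ _) _

theorem setLIntegral_ball_eq (δ s : ℝ) (F : RN N → ℝ≥0∞) :
    ∫⁻ h in Metric.ball (0 : RN N) δ, kernel N s ‖h‖ * F h =
      ∫⁻ h, (Iio δ).indicator (kernel N s) ‖h‖ * F h := by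
  rw [← lintegral_indicator measurableSet_ball]
  refine lintegral_congr fun h => ?_
  by_cases hh : ‖h‖ < δ
  · rw [indicator_of_mem (by simpa using hh), indicator_of_mem (show ‖h‖ ∈ Iio δ from hh)]
  · rw [indicator_of_notMem (by simpa using hh),
      indicator_of_notMem (show ‖h‖ ∉ Iio δ from hh), zero_mul]

theorem lintegral_radial_mul_lintegral_pairing {g : ℝ → ℝ≥0∞} (hg : Measurable g) {e : RN N}
    (he : ‖e‖ = 1) {V : RN N → CN N} (hVm : Measurable V) :
    ∫⁻ h : RN N, g ‖h‖ * ∫⁻ x, ‖pairing h (V x)‖ₑ ^ 2 =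
      radialMoment g e * ∫⁻ x, ‖V x‖ₑ ^ 2 := by
  have hp : Measurable fun p : RN N × RN N => pairing p.1 (V p.2) :=
    continuous_pairing.measurable.comp (measurable_fst.prodMk (hVm.comp measurable_snd))
  have hpm : Measurable fun p : RN N × RN N => ‖pairing p.1 (V p.2)‖ₑ ^ 2 :=
    hp.enorm.pow_const 2
  have hgm : Measurable fun p : RN N × RN N => g ‖p.1‖ := hg.comp measurable_fst.norm
  calc _ = ∫⁻ h : RN N, ∫⁻ x, g ‖h‖ * ‖pairing h (V x)‖ₑ ^ 2 :=
        lintegral_congr fun h => (lintegral_const_mul _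
          (hpm.comp (measurable_const.prodMk measurable_id))).symm
    _ = ∫⁻ x, ∫⁻ h : RN N, g ‖h‖ * ‖pairing h (V x)‖ₑ ^ 2 :=
        lintegral_lintegral_swap (hgm.mul hpm).aemeasurable
    _ = ∫⁻ x, radialMoment g e * ‖V x‖ₑ ^ 2 :=
        lintegral_congr fun x => lintegral_radial_mul_pairing hg he (V x)
    _ = _ := lintegral_const_mul _ (hVm.enorm.pow_const 2)

/-- Concentration of the kernels `(1 - s) |h|^{-N-2s}` against functions that are quadratic at
the origin up to `o(|h|²)`. -/
theorem tendsto_kernel {e : RN N} (he : ‖e‖ = 1) {V : RN N → CN N} (hVm : Measurable V)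
    (hV : ∫⁻ x, ‖V x‖ₑ ^ 2 ≠ ⊤) {F : RN N → ℝ≥0∞} (hF : ∫⁻ h, F h ≠ ⊤)
    (hFV : ∀ ε : ℝ≥0∞, ε ≠ 0 → ∀ᶠ h in 𝓝 (0 : RN N),
      F h ≤ (∫⁻ x, ‖pairing h (V x)‖ₑ ^ 2) + ε * ‖h‖ₑ ^ 2 ∧
      ∫⁻ x, ‖pairing h (V x)‖ₑ ^ 2 ≤ F h + ε * ‖h‖ₑ ^ 2) :
    Tendsto (fun s => ENNReal.ofReal (1 - s) * ∫⁻ h, kernel N s ‖h‖ * F h) (𝓝[<] 1)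
      (𝓝 (ENNReal.ofReal (bbmConstant e) * ∫⁻ x, ‖V x‖ₑ ^ 2)) := by
  set E := ∫⁻ x, ‖V x‖ₑ ^ 2
  set K := ENNReal.ofReal (bbmConstant e) with hK
  have hKE : K * E ≠ ⊤ := ENNReal.mul_ne_top ENNReal.ofReal_ne_top hV
  rw [ENNReal.tendsto_nhds hKE]
  intro ε hε
  -- The budget is `4κ`: one `κ` for the main term, two for the quadratic error (its limit and the
  -- tolerance), one for the far part. The minimum with 1 keeps `κ` finite when `ε = ⊤`.
  set κ := min 1 (ε / 4) with hκ
  have hκ0 : 0 < κ := lt_min one_pos (ENNReal.div_pos hε.ne' (by norm_num))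
  have hκt : κ ≠ ⊤ := ne_top_of_le_ne_top ENNReal.one_ne_top (min_le_left _ _)
  have hκε : 4 * κ ≤ ε := (mul_le_mul_right (min_le_right _ _) _).trans ENNReal.mul_div_le
  have hNK : (N : ℝ≥0∞) * K + 1 ≠ ⊤ :=
    ENNReal.add_ne_top.mpr ⟨ENNReal.mul_ne_top (ENNReal.natCast_ne_top N) ENNReal.ofReal_ne_top,
      ENNReal.one_ne_top⟩
  -- Chosen so that the limit `η N K` of the quadratic error is at most `κ`; the `+ 1` keeps the
  -- denominator nonzero.
  set η := κ / (N * K + 1) with hη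
  have hη0 : η ≠ 0 := (ENNReal.div_pos hκ0.ne' hNK).ne'
  have hηN : η * N * K ≤ κ := by
    calc η * N * K = (N * K) * η := by ring
      _ ≤ (N * K + 1) * η := by gcongr; exact le_self_add
      _ ≤ κ := ENNReal.mul_div_le
  have hηt : η ≠ ⊤ := (ENNReal.div_lt_top hκt (by simp)).ne
  have hηN' : η * N ≠ ⊤ := ENNReal.mul_ne_top hηt (ENNReal.natCast_ne_top N)
  obtain ⟨δ₀, hδ₀, Hδ⟩ := Metric.eventually_nhds_iff_ball.mp (hFV η hη0)
  set δ := min δ₀ 1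
  have hδ : 0 < δ := lt_min hδ₀ one_pos
  have hfar := tendsto_far hF hδ (min_le_right _ _)
  have hI := tendsto_radialMoment_kernel he hδ
  set I : ℝ → ℝ≥0∞ := fun s => radialMoment ((Iio δ).indicator (kernel N s)) e
  have hIE : Tendsto (fun s => ENNReal.ofReal (1 - s) * I s * E) (𝓝[<] 1) (𝓝 (K * E)) :=
    ENNReal.Tendsto.mul_const hI (Or.inr hV)
  have hIN : Tendsto (fun s => η * N * (ENNReal.ofReal (1 - s) * I s)) (𝓝[<] 1)
      (𝓝 (η * N * K)) := ENNReal.Tendsto.const_mul hI (Or.inr hηN')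
  have e1 := (ENNReal.tendsto_nhds hKE).mp hIE κ hκ0
  have e2 := (ENNReal.tendsto_nhds (ne_top_of_le_ne_top hκt hηN)).mp hIN κ hκ0
  have e3 := (ENNReal.tendsto_nhds_zero.mp hfar) κ hκ0
  have hgm (s : ℝ) : Measurable ((Iio δ).indicator (kernel N s)) :=
    (measurable_kernel N s).indicator measurableSet_Iio
  have hq (s : ℝ) : ∫⁻ h : RN N, (Iio δ).indicator (kernel N s) ‖h‖ *
      ∫⁻ x, ‖pairing h (V x)‖ₑ ^ 2 = I s * E :=
    lintegral_radial_mul_lintegral_pairing (hgm s) he hVm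
  have hn (s : ℝ) : ∫⁻ h : RN N, (Iio δ).indicator (kernel N s) ‖h‖ * (η * ‖h‖ₑ ^ 2) =
      η * N * I s := by
    rw [mul_assoc, ← lintegral_radial_mul_norm_sq (hgm s) he,
      ← lintegral_const_mul' η _ hηt]
    exact lintegral_congr fun h => mul_left_comm _ _ _
  have hgn (s : ℝ) : Measurable fun h : RN N =>
      (Iio δ).indicator (kernel N s) ‖h‖ * (η * ‖h‖ₑ ^ 2) :=
    ((hgm s).comp measurable_norm).mul ((measurable_enorm.pow_const 2).const_mul η)
  have hmono (s : ℝ) {f₁ f₂ : RN N → ℝ≥0∞} (hf : ∀ h ∈ Metric.ball (0 : RN N) δ₀,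
      f₁ h ≤ f₂ h + η * ‖h‖ₑ ^ 2) :
      ∫⁻ h : RN N, (Iio δ).indicator (kernel N s) ‖h‖ * f₁ h ≤
        (∫⁻ h : RN N, (Iio δ).indicator (kernel N s) ‖h‖ * f₂ h) + η * N * I s := by
    rw [← hn, ← lintegral_add_right _ (hgn s)]
    refine lintegral_mono fun h => ?_
    rw [← mul_add]
    by_cases hh : ‖h‖ < δ
    · gcongr
      exact hf h (by simpa using hh.trans_le (min_le_left _ _))
    · rw [indicator_of_notMem (show ‖h‖ ∉ Iio δ from hh), zero_mul]
      exact bot_le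
  have hsplit (s : ℝ) : ∫⁻ h, kernel N s ‖h‖ * F h =
      (∫⁻ h : RN N, (Iio δ).indicator (kernel N s) ‖h‖ * F h) +
        ∫⁻ h in (Metric.ball (0 : RN N) δ)ᶜ, kernel N s ‖h‖ * F h := by
    rw [← setLIntegral_ball_eq, lintegral_add_compl _ measurableSet_ball]
  filter_upwards [e1, e2, e3] with s h1 h2 h3
  have hb2 : η * N * (ENNReal.ofReal (1 - s) * I s) ≤ 2 * κ := by
    calc _ ≤ η * N * K + κ := h2.2
      _ ≤ κ + κ := by gcongr
      _ = 2 * κ := by ring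
  constructor
  · rw [tsub_le_iff_right]
    have hle := hmono s (f₁ := fun h => ∫⁻ x, ‖pairing h (V x)‖ₑ ^ 2) (f₂ := F)
      fun h hh => (Hδ h hh).2
    rw [hq] at hle
    calc K * E ≤ ENNReal.ofReal (1 - s) * I s * E + κ := tsub_le_iff_right.mp h1.1
      _ = ENNReal.ofReal (1 - s) * (I s * E) + κ := by rw [mul_assoc]
      _ ≤ ENNReal.ofReal (1 - s) * ((∫⁻ h, kernel N s ‖h‖ * F h) + η * N * I s) + κ := by
          gcongr
          refine hle.trans ?_
          rw [hsplit s]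
          gcongr
          exact le_self_add
      _ = ENNReal.ofReal (1 - s) * (∫⁻ h, kernel N s ‖h‖ * F h) +
          (η * N * (ENNReal.ofReal (1 - s) * I s) + κ) := by ring
      _ ≤ ENNReal.ofReal (1 - s) * (∫⁻ h, kernel N s ‖h‖ * F h) + (2 * κ + κ) := by gcongr
      _ ≤ ENNReal.ofReal (1 - s) * (∫⁻ h, kernel N s ‖h‖ * F h) + 4 * κ := by
          have : 2 * κ + κ = 3 * κ := by ring
          rw [this]
          gcongr
          norm_num
      _ ≤ _ := by gcongr
  · have hle := hmono s (f₁ := F) (f₂ := fun h => ∫⁻ x, ‖pairing h (V x)‖ₑ ^ 2)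
      fun h hh => (Hδ h hh).1
    rw [hq] at hle
    calc ENNReal.ofReal (1 - s) * ∫⁻ h, kernel N s ‖h‖ * F h
        ≤ ENNReal.ofReal (1 - s) * ((I s * E + η * N * I s) +
          ∫⁻ h in (Metric.ball (0 : RN N) δ)ᶜ, kernel N s ‖h‖ * F h) := by
          rw [hsplit s]
          gcongr
      _ = ENNReal.ofReal (1 - s) * I s * E + (η * N * (ENNReal.ofReal (1 - s) * I s) +
          ENNReal.ofReal (1 - s) *
            ∫⁻ h in (Metric.ball (0 : RN N) δ)ᶜ, kernel N s ‖h‖ * F h) := by ring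
      _ ≤ (K * E + κ) + (2 * κ + κ) := by
          gcongr
          exact h1.2
      _ = K * E + 4 * κ := by ring
      _ ≤ _ := by gcongr

end Limit

/-! ### Reduction to measurable representatives extended by zero. -/

section Reduction

theorem ofReal_sq_div_rpow (a : ℂ) (h : RN N) (s : ℝ) :
    ENNReal.ofReal (‖a‖ ^ 2 / ‖h‖ ^ ((N : ℝ) + 2 * s)) = kernel N s ‖h‖ * ‖a‖ₑ ^ 2 := by
  rw [kernel, div_eq_mul_inv, ← Real.rpow_neg (norm_nonneg h), mul_comm,
    ENNReal.ofReal_mul (Real.rpow_nonneg (norm_nonneg h) _), ENNReal.ofReal_pow (norm_nonneg a),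
    ofReal_norm]

/-- For fixed `x` the midpoint map is a translation followed by a dilation, so preimages of null
sets are null. This permits changing `A` on a null set. -/
theorem ae_comp_midpoint {p : RN N → Prop} (hp : ∀ᵐ z, p z) (x : RN N) :
    ∀ᵐ y : RN N, p ((2⁻¹ : ℝ) • (x + y)) := by
  rw [ae_iff] at hp ⊢
  have h1 : volume ((fun z : RN N => (2⁻¹ : ℝ) • z) ⁻¹' {z | ¬ p z}) = 0 := by
    rw [Measure.addHaar_preimage_smul _ (by norm_num), hp, mul_zero]
  rw [← measure_preimage_add volume x] at h1
  exact h1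

/-- The set `B` is separate from `Ω` because midpoints of points of `Ω` may lie outside `Ω`. -/
theorem magneticGagliardo_congr {Ω B : Set (RN N)} (hΩ : MeasurableSet Ω) {A A' : RN N → RN N}
    {u u' : RN N → ℂ} (hu : ∀ᵐ x, x ∈ Ω → u x = u' x) (hA : ∀ᵐ z, z ∈ B → A z = A' z)
    (hB : ∀ x ∈ Ω, ∀ y ∈ Ω, (2⁻¹ : ℝ) • (x + y) ∈ B) (s : ℝ) :
    magneticGagliardo s Ω A u = magneticGagliardo s Ω A' u' := by
  refine setLIntegral_congr_fun_ae hΩ ?_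
  filter_upwards [hu] with x hx hxΩ
  refine setLIntegral_congr_fun_ae hΩ ?_
  filter_upwards [hu, ae_comp_midpoint hA x] with y hy hyA hyΩ
  rw [hx hxΩ, hy hyΩ, hyA (hB x hxΩ y hyΩ)]

theorem setLIntegral_magnetic_eq {Ω : Set (RN N)} (hΩ : MeasurableSet Ω) (A : RN N → RN N)
    (U : RN N → ℂ) (s : ℝ) {x : RN N} (hx : x ∈ Ω) :
    (∫⁻ y in Ω, ENNReal.ofReal
      (‖U x - Complex.exp (Complex.I * ((inner ℝ (x - y) (A ((2⁻¹ : ℝ) • (x + y))) : ℝ) : ℂ)) *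
        U y‖ ^ 2 / ‖x - y‖ ^ ((N : ℝ) + 2 * s))) =
      ∫⁻ h : RN N, kernel N s ‖h‖ * ‖magneticDifference Ω A U h x‖ₑ ^ 2 := by
  rw [← lintegral_indicator hΩ, ← lintegral_add_left_eq_self _ x]
  refine lintegral_congr fun h => ?_
  by_cases hxh : x + h ∈ Ω
  · have e1 : x - (x + h) = -h := by abel
    have e2 : (2⁻¹ : ℝ) • (x + (x + h)) = x + (2⁻¹ : ℝ) • h := by module
    rw [indicator_of_mem hxh, e1, e2, norm_neg, ofReal_sq_div_rpow, magneticDifference,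
      indicator_of_mem (show x ∈ {x | x ∈ Ω ∧ x + h ∈ Ω} from ⟨hx, hxh⟩)]
  · rw [indicator_of_notMem hxh, magneticDifference, indicator_of_notMem fun h => hxh h.2]
    simp

theorem setLIntegral_lintegral_magneticDifference (Ω : Set (RN N)) (A : RN N → RN N)
    (U : RN N → ℂ) (k : RN N → ℝ≥0∞) :
    ∫⁻ x in Ω, ∫⁻ h : RN N, k h * ‖magneticDifference Ω A U h x‖ₑ ^ 2 =
      ∫⁻ x, ∫⁻ h : RN N, k h * ‖magneticDifference Ω A U h x‖ₑ ^ 2 := by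
  refine setLIntegral_eq_of_support_subset fun x hx => ?_
  by_contra hxΩ
  refine hx ?_
  have (h : RN N) : magneticDifference Ω A U h x = 0 :=
    indicator_of_notMem (fun h => hxΩ h.1) _
  simp [this]

theorem IsSobolevPair.magneticGagliardo_eq {Ω : Set (RN N)} {U : RN N → ℂ} {W : RN N → CN N}
    (hs : IsSobolevPair Ω U W) {A : RN N → RN N} (hA : Measurable A) (s : ℝ) :
    magneticGagliardo s Ω A U =
      ∫⁻ h : RN N, kernel N s ‖h‖ * eLpNorm (magneticDifference Ω A U h) 2 volume ^ 2 := by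
  have hQ : Measurable fun p : RN N × RN N => magneticDifference Ω A U p.1 p.2 :=
    hs.measurable_magneticDifference_uncurry hA
  have hΩ := hs.isOpen.measurableSet
  unfold magneticGagliardo
  rw [setLIntegral_congr_fun hΩ fun x hx => setLIntegral_magnetic_eq hΩ A U s hx,
    setLIntegral_lintegral_magneticDifference]
  generalize magneticDifference Ω A U = Q at hQ
  have hQ2 : Measurable fun p : RN N × RN N => ‖Q p.1 p.2‖ₑ ^ 2 := hQ.enorm.pow_const 2
  have hk : Measurable fun p : RN N × RN N => kernel N s ‖p.1‖ :=
    (measurable_kernel N s).comp measurable_fst.norm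
  have hkQ : Measurable (Function.uncurry fun h x : RN N => kernel N s ‖h‖ * ‖Q h x‖ₑ ^ 2) :=
    hk.mul hQ2
  rw [← lintegral_lintegral_swap hkQ.aemeasurable]
  refine lintegral_congr fun h => ?_
  rw [eLpNorm_two_sq]
  exact lintegral_const_mul _ (hQ2.comp (measurable_const.prodMk measurable_id))

/-- The phase is unimodular, so the norm is at most twice that of `U`, and steps longer than the
diameter bound `2R` give zero. -/
theorem IsSobolevPair.lintegral_magneticDifference_ne_top {Ω : Set (RN N)} {U : RN N → ℂ}
    {W : RN N → CN N} (hs : IsSobolevPair Ω U W) (A : RN N → RN N) :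
    ∫⁻ h : RN N, eLpNorm (magneticDifference Ω A U h) 2 volume ^ 2 ≠ ⊤ := by
  obtain ⟨R, hR⟩ := hs.isBounded.subset_closedBall (0 : RN N)
  have hUm := hs.measurable_fun
  have hle (h : RN N) : eLpNorm (magneticDifference Ω A U h) 2 volume ≤
      2 * eLpNorm U 2 volume := by
    have h1 : eLpNorm (magneticDifference Ω A U h) 2 volume ≤
        eLpNorm ((fun x => ‖U x‖) + fun x => ‖U (x + h)‖) 2 volume := by
      refine eLpNorm_mono_real fun x => ?_
      refine (norm_indicator_le_norm_self _ x).trans ((norm_sub_le _ _).trans ?_)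
      rw [norm_mul, mul_comm Complex.I, Complex.norm_exp_ofReal_mul_I, one_mul]
      exact le_rfl
    have hUh : Measurable fun x => ‖U (x + h)‖ := (hUm.comp (measurable_add_const h)).norm
    refine h1.trans ((eLpNorm_add_le hUm.norm.aestronglyMeasurable
      hUh.aestronglyMeasurable (by norm_num)).trans ?_)
    have h2 : eLpNorm (fun x => ‖U (x + h)‖) 2 volume = eLpNorm U 2 volume := by
      rw [← eLpNorm_comp_add_right U hUm.stronglyMeasurable h]
      exact eLpNorm_norm _
    rw [h2, eLpNorm_norm, two_mul]
  have hsupp : ∀ h ∉ Metric.closedBall (0 : RN N) (2 * R),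
      eLpNorm (magneticDifference Ω A U h) 2 volume ^ 2 = 0 := by
    intro h hh
    have : magneticDifference Ω A U h = 0 := by
      ext x
      refine indicator_of_notMem (fun hx => hh ?_) _
      have h1 := hR hx.1
      have h2 := hR hx.2
      rw [mem_closedBall_zero_iff] at h1 h2 ⊢
      calc ‖h‖ = ‖(x + h) - x‖ := by congr 1; abel
        _ ≤ ‖x + h‖ + ‖x‖ := norm_sub_le _ _
        _ ≤ 2 * R := by linarith
    rw [this]
    simp
  have hfin : ∫⁻ h in Metric.closedBall (0 : RN N) (2 * R), (2 * eLpNorm U 2 volume) ^ 2 ≠ ⊤ := by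
    rw [setLIntegral_const]
    exact ENNReal.mul_ne_top (ENNReal.pow_ne_top (ENNReal.mul_ne_top (by norm_num)
      hs.memLp_fun.eLpNorm_ne_top)) measure_closedBall_lt_top.ne
  refine ne_top_of_le_ne_top hfin ?_
  rw [← lintegral_indicator measurableSet_closedBall]
  refine lintegral_mono fun h => ?_
  by_cases hh : h ∈ Metric.closedBall (0 : RN N) (2 * R)
  · rw [indicator_of_mem hh]
    gcongr
    exact hle h
  · rw [hsupp h hh]
    exact bot_le

theorem IsSobolevPair.tendsto_magneticGagliardo {Ω : Set (RN N)} {U : RN N → ℂ}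
    {W : RN N → CN N} (hs : IsSobolevPair Ω U W) (hlip : HasLipschitzBoundary Ω)
    {A : RN N → RN N} (hA : Measurable A) {M : ℝ} (hM0 : 0 ≤ M) (hM : ∀ x, ‖A x‖ ≤ M) {e : RN N}
    (he : ‖e‖ = 1) :
    Tendsto (fun s : ℝ => ENNReal.ofReal (1 - s) * magneticGagliardo s Ω A U) (𝓝[<] 1)
      (𝓝 (ENNReal.ofReal (bbmConstant e) * ∫⁻ x, ‖magneticGradient A U W x‖ₑ ^ 2)) := by
  simp_rw [hs.magneticGagliardo_eq hA]
  have hV := (hs.memLp_magneticGradient hA hM).eLpNorm_ne_top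
  refine tendsto_kernel he (hs.measurable_magneticGradient hA) ?_
    (hs.lintegral_magneticDifference_ne_top A) fun ε hε => ?_
  · rw [← eLpNorm_two_sq]
    exact ENNReal.pow_ne_top hV
  · simp_rw [← eLpNorm_two_sq (μ := volume)]
    exact hs.eventually_sq_le hlip hA hM0 hM hε

/-- Fundamental lemma of the calculus of variations. It identifies the gradient used in the energy
with the one furnished by membership in the magnetic Sobolev space. -/
theorem HasWeakGradient.ae_eq {Ω : Set (RN N)} (hΩ : IsOpen Ω) {u : RN N → ℂ}
    {D₁ D₂ : RN N → CN N} (h₁ : HasWeakGradient Ω u D₁) (h₂ : HasWeakGradient Ω u D₂) :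
    ∀ᵐ x, x ∈ Ω → D₁ x = D₂ x := by
  have hcoord (j : Fin N) {D : RN N → CN N} (hD : LocallyIntegrableOn D Ω) :
      LocallyIntegrableOn (fun x => D x j) Ω := fun x hx => by
    obtain ⟨t, ht, hi⟩ := hD x hx
    exact ⟨t, ht, (EuclideanSpace.proj (𝕜 := ℂ) j).integrable_comp hi⟩
  have key (j : Fin N) : ∀ᵐ x, x ∈ Ω → D₁ x j - D₂ x j = 0 := by
    refine hΩ.ae_eq_zero_of_integral_contDiff_smul_eq_zero
      ((hcoord j h₁.2.1).sub (hcoord j h₂.2.1)) fun φ hφ hc hsub => ?_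
    have hint {D : RN N → CN N} (hD : LocallyIntegrableOn D Ω) :
        Integrable fun x => (φ x : ℂ) * D x j := by
      have hK : IntegrableOn (fun x => D x j) (tsupport φ) :=
        (hcoord j hD).integrableOn_compact_subset hsub hc
      have h1 : IntegrableOn (fun x => (φ x : ℂ) * D x j) (tsupport φ) :=
        hK.continuousOn_mul (Complex.continuous_ofReal.comp hφ.continuous).continuousOn hc
      refine (integrableOn_iff_integrable_of_support_subset fun x hx => ?_).mp h1
      by_contra hxs
      exact hx (by simp [image_eq_zero_of_notMem_tsupport hxs])
    have hset (D : RN N → CN N) : ∫ x in Ω, (φ x : ℂ) * D x j = ∫ x, (φ x : ℂ) * D x j := by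
      refine setIntegral_eq_integral_of_forall_compl_eq_zero fun x hx => ?_
      simp [image_eq_zero_of_notMem_tsupport fun h => hx (hsub h)]
    have heq := (h₁.2.2 φ hφ hc hsub j).symm.trans (h₂.2.2 φ hφ hc hsub j)
    rw [hset, hset, neg_inj] at heq
    simp only [Complex.real_smul, mul_sub]
    rw [integral_sub (hint h₁.2.1) (hint h₂.2.1), heq, sub_self]
  filter_upwards [ae_all_iff.mpr key] with x hx hxΩ
  ext j
  exact sub_eq_zero.mp (hx j hxΩ)

theorem memLp_indicator_mk {F : Type*} [NormedAddCommGroup F] {Ω : Set (RN N)}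
    (hΩ : MeasurableSet Ω) {f g : RN N → F} (hf : MemLp f 2 (volume.restrict Ω))
    (hfg : ∀ᵐ x, x ∈ Ω → f x = g x) : MemLp (Ω.indicator g) 2 volume := by
  rw [memLp_indicator_iff_restrict hΩ]
  exact hf.ae_eq ((ae_restrict_iff' hΩ).mpr hfg)

theorem exists_measurable_indicator {F : Type*} [NormedAddCommGroup F] [MeasurableSpace F]
    [BorelSpace F] {Ω : Set (RN N)} (hΩ : MeasurableSet Ω) {f : RN N → F}
    (hf : MemLp f 2 (volume.restrict Ω)) :
    ∃ g : RN N → F, Measurable g ∧ MemLp g 2 volume ∧ (∀ x ∉ Ω, g x = 0) ∧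
      ∀ᵐ x, x ∈ Ω → f x = g x := by
  have h := hf.aestronglyMeasurable
  have hae : ∀ᵐ x, x ∈ Ω → f x = h.mk f x := (ae_restrict_iff' hΩ).mp h.ae_eq_mk
  refine ⟨Ω.indicator (h.mk f), h.stronglyMeasurable_mk.measurable.indicator hΩ,
    memLp_indicator_mk hΩ hf hae, fun x hx => indicator_of_notMem hx _, ?_⟩
  filter_upwards [hae] with x hx hxΩ
  rw [hx hxΩ, indicator_of_mem hxΩ]

theorem exists_bounded_measurable {A : RN N → RN N} (hA : AEMeasurable A volume) {B : Set (RN N)}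
    (hB : MeasurableSet B) {M : ℝ} (hM : ∀ z ∈ B, ‖A z‖ ≤ M) (hM0 : 0 ≤ M) :
    ∃ A' : RN N → RN N, Measurable A' ∧ (∀ x, ‖A' x‖ ≤ M) ∧ ∀ᵐ z, z ∈ B → A z = A' z := by
  have hAm := hA.measurable_mk
  -- The measurable representative may exceed `M` on a null part of `B`; cutting down to `T` gives a
  -- bound at every point.
  set T : Set (RN N) := {z | ‖hA.mk A z‖ ≤ M}
  have hT : MeasurableSet T := measurableSet_le hAm.norm measurable_const
  refine ⟨(B ∩ T).indicator (hA.mk A), hAm.indicator (hB.inter hT), fun x => ?_, ?_⟩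
  · by_cases hx : x ∈ B ∩ T
    · rw [indicator_of_mem hx]
      exact hx.2
    · rwa [indicator_of_notMem hx, norm_zero]
  · filter_upwards [hA.ae_eq_mk] with z hz hzB
    have : z ∈ B ∩ T := ⟨hzB, by
      change ‖hA.mk A z‖ ≤ M
      rw [← hz]
      exact hM z hzB⟩
    rw [indicator_of_mem this, hz]

theorem IsWeakGradient.of_hasWeakGradient {Ω : Set (RN N)} (hΩ : MeasurableSet Ω)
    {u U : RN N → ℂ} {Du W : RN N → CN N} (h : HasWeakGradient Ω u Du)
    (hU : ∀ᵐ x, x ∈ Ω → u x = U x) (hW : ∀ᵐ x, x ∈ Ω → Du x = W x)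
    (hU0 : ∀ x ∉ Ω, U x = 0) (hW0 : ∀ x ∉ Ω, W x = 0) : IsWeakGradient Ω U W := by
  intro φ hφ hc hsub j
  have h1 : ∫ x in Ω, (fderiv ℝ φ x (EuclideanSpace.single j 1) : ℂ) * u x =
      ∫ x, (fderiv ℝ φ x (EuclideanSpace.single j 1) : ℂ) * U x := by
    refine Eq.trans (setIntegral_congr_ae hΩ ?_)
      (setIntegral_eq_integral_of_forall_compl_eq_zero fun x hx => by rw [hU0 x hx, mul_zero])
    filter_upwards [hU] with x hx hxΩ
    rw [hx hxΩ]
  have h2 : ∫ x in Ω, (φ x : ℂ) * Du x j = ∫ x, (φ x : ℂ) * W x j := by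
    refine Eq.trans (setIntegral_congr_ae hΩ ?_)
      (setIntegral_eq_integral_of_forall_compl_eq_zero fun x hx => by simp [hW0 x hx])
    filter_upwards [hW] with x hx hxΩ
    rw [hx hxΩ]
  rw [← h1, ← h2]
  exact h.2.2 φ hφ hc hsub j

/-- `∇u = (∇u - iAu) + iAu`, and `A` is bounded on `Ω`. -/
theorem memLp_weakGradient {Ω : Set (RN N)} (hΩ : MeasurableSet Ω) {A : RN N → RN N}
    {M : ℝ} (hM : ∀ z ∈ Ω, ‖A z‖ ≤ M)
    {u : RN N → ℂ} (hu : MemLp u 2 (volume.restrict Ω)) {Du : RN N → CN N}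
    (hAm : AEMeasurable A volume)
    (hV : MemLp (magneticGradient A u Du) 2 (volume.restrict Ω)) :
    MemLp Du 2 (volume.restrict Ω) := by
  have hm : AEStronglyMeasurable (potentialTerm A u) (volume.restrict Ω) := by
    refine AEMeasurable.aestronglyMeasurable
      ((PiLp.continuous_toLp 2 _).measurable.comp_aemeasurable (aemeasurable_pi_lambda _ fun j => ?_))
    have : AEMeasurable (fun x => A x j) (volume.restrict Ω) :=
      (EuclideanSpace.proj (𝕜 := ℝ) j).continuous.measurable.comp_aemeasurable hAm.restrict
    exact (Complex.measurable_ofReal.comp_aemeasurable this).mul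
      hu.aestronglyMeasurable.aemeasurable
  have hP : MemLp (potentialTerm A u) 2 (volume.restrict Ω) := by
    refine hu.of_le_mul (c := M) hm ?_
    filter_upwards [ae_restrict_mem hΩ] with x hx
    rw [norm_potentialTerm]
    gcongr
    exact hM x hx
  have := hV.add (hP.const_smul Complex.I)
  rwa [magneticGradient_eq, sub_add_cancel] at this

theorem magneticEnergy_eq {Ω : Set (RN N)} (hΩ : MeasurableSet Ω) {A A' : RN N → RN N}
    {u U : RN N → ℂ} {Du W : RN N → CN N} (hA : ∀ᵐ x, x ∈ Ω → A x = A' x)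
    (hU : ∀ᵐ x, x ∈ Ω → u x = U x) (hW : ∀ᵐ x, x ∈ Ω → Du x = W x)
    (hU0 : ∀ x ∉ Ω, U x = 0) (hW0 : ∀ x ∉ Ω, W x = 0) :
    magneticEnergy Ω A u Du = ∫⁻ x, ‖magneticGradient A' U W x‖ₑ ^ 2 := by
  rw [magneticEnergy, ← lintegral_indicator hΩ]
  refine lintegral_congr_ae ?_
  filter_upwards [hA, hU, hW] with x h1 h2 h3
  by_cases hx : x ∈ Ω
  · rw [indicator_of_mem hx, ENNReal.ofReal_pow (norm_nonneg _), ofReal_norm]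
    simp only [magneticGradient, h1 hx, h2 hx, h3 hx]
  · rw [indicator_of_notMem hx]
    have : magneticGradient A' U W x = 0 := by
      ext j
      simp [magneticGradient, hU0 x hx, hW0 x hx]
    rw [this]
    simp

end Reduction

end MagneticBBM

theorem theorem1p1 (N : ℕ) (Ω : Set (MagneticBBM.RN N)) (hΩ_open : IsOpen Ω)
    (hΩ_bdd : Bornology.IsBounded Ω) (hΩ_lip : MagneticBBM.HasLipschitzBoundary Ω)
    (A : MagneticBBM.RN N → MagneticBBM.RN N) (hA_meas : AEMeasurable A volume)
    (hA_bdd : MagneticBBM.IsLocallyBounded A) (hA : MagneticBBM.IsC2OnClosure Ω A)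
    (u : MagneticBBM.RN N → ℂ) (hu : MagneticBBM.MemMagneticH1 Ω A u)
    (Du : MagneticBBM.RN N → MagneticBBM.CN N) (hDu : MagneticBBM.HasWeakGradient Ω u Du)
    (e : MagneticBBM.RN N) (he : ‖e‖ = 1) :
    Tendsto (fun s : ℝ => ENNReal.ofReal (1 - s) * MagneticBBM.magneticGagliardo s Ω A u)
      (𝓝[<] 1)
      (𝓝 (ENNReal.ofReal (MagneticBBM.bbmConstant e) * MagneticBBM.magneticEnergy Ω A u Du)) := by
  open MagneticBBM in
  obtain ⟨hu2, Du', hDu', hV⟩ := hu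
  have hΩm := hΩ_open.measurableSet
  obtain ⟨R, hR⟩ := hΩ_bdd.subset_closedBall (0 : RN N)
  -- A closed ball is compact, so `A` is bounded on it, and convex, so it contains the midpoints of
  -- pairs in `Ω`.
  set B : Set (RN N) := Metric.closedBall 0 R with hB
  obtain ⟨M, hM⟩ := (hA_bdd B (isCompact_closedBall 0 R)).exists_norm_le
  have hMB : ∀ z ∈ B, ‖A z‖ ≤ max M 0 := fun z hz =>
    (hM _ (mem_image_of_mem A hz)).trans (le_max_left _ _)
  have hmid : ∀ x ∈ Ω, ∀ y ∈ Ω, (2⁻¹ : ℝ) • (x + y) ∈ B := fun x hx y hy => by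
    rw [smul_add]
    exact convex_closedBall 0 R (hR hx) (hR hy) (by norm_num) (by norm_num) (by norm_num)
  obtain ⟨A', hA'm, hA'M, hA'⟩ :=
    exists_bounded_measurable hA_meas measurableSet_closedBall hMB (le_max_right _ _)
  obtain ⟨U, hUm, hU2, hU0, hU⟩ := exists_measurable_indicator hΩm hu2
  obtain ⟨W, hWm, hW2, hW0, hW'⟩ := exists_measurable_indicator hΩm
    (memLp_weakGradient hΩm (fun z hz => hMB z (hR hz)) hu2 hA_meas hV)
  have hW : ∀ᵐ x, x ∈ Ω → Du x = W x := by
    filter_upwards [hDu.ae_eq hΩ_open hDu', hW'] with x h1 h2 hx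
    rw [h1 hx, h2 hx]
  have hs : IsSobolevPair Ω U W := ⟨hΩ_open, hΩ_bdd, hUm, hWm, hU2, hW2, hU0, hW0,
    IsWeakGradient.of_hasWeakGradient hΩm hDu hU hW hU0 hW0⟩
  have hAΩ : ∀ᵐ x, x ∈ Ω → A x = A' x := hA'.mono fun x hx hxΩ => hx (hR hxΩ)
  rw [magneticEnergy_eq hΩm hAΩ hU hW hU0 hW0]
  simp_rw [magneticGagliardo_congr hΩm hU hA' hmid]
  exact hs.tendsto_magneticGagliardo hΩ_lip hA'm (le_max_right _ _) hA'M he
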